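/- All graphs are finite, simple, undirected and nonempty. The clique-width of a graph is the minimum number of labels needed to construct it by the operations: create a single labelled vertex; take the disjoint union of two labelled graphs; join every vertex labelled $i$ to every vertex labelled $j$ ($i\neq j$); relabel every vertex labelled $i$ to $j$. A class of graphs has bounded clique-width if some constant bounds the clique-width of all its members, and unbounded clique-width otherwise. An atom is a graph with no clique cut-set, that is, no (possibly empty) clique whose deletion leaves a disconnected graph. A graph is $(H_1,\dots,H_p)$-free if it contains no $H_i$ as an induced subgraph. $\overline{G}$ is the complement of $G$, $P_t$ and $C_t$ are the path and the cycle on $t$ vertices, and $rG$ is the disjoint union of $r$ copies of $G$. The wall of height $k\ge 2$ has as vertices the integer points $(x,y)$ with $0\le x\le 2k+1$ and $0\le y\le k$, except $(0,0)$ and except $(0,k)$ if $k$ is odd, respectively $(2k+1,k)$ if $k$ is even; $(x,y)$ is adjacent to $(x+1,y)$ always, and to $(x,y+1)$ if $x+y$ is odd (whenever both are vertices). **Lemma.** 1. The class of $(2P_2,\overline{P_5},\overline{3P_2})$-free atoms has unbounded clique-width. 2. This is witnessed by the following graphs. For every $k\ge 2$ the wall of height $k$ is bipartite. For each bipartition $(A,B)$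 of it, let $H_k(A)$ be the graph obtained by making $A$ a clique and adding two non-adjacent vertices $x,y$, each adjacent to all of $A\cup B$. Then every $H_k(A)$ is a $(2P_2,\overline{P_5},\overline{3P_2})$-free atom, and for any choice of bipartitions $(A_k,B_k)$, $k\ge 2$, the class $\{H_k(A_k) : k\ge 2\}$ has unbounded clique-width. 3. The class of $(\overline{C_4},\overline{P_5})$-free atoms has unbounded clique-width, whereas the class of $(C_4,P_5)$-free atoms has bounded clique-width. -/

import Mathlib

/-- A nonempty finite simple undirected graph. -/
structure FinGraph : Type 1 where
  /-- the vertex set -/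
  V : Type
  [finite : Finite V]
  [nonempty : Nonempty V]
  /-- the adjacency relation -/
  graph : SimpleGraph V

attribute [instance] FinGraph.finite FinGraph.nonempty

/-- The bundled version of a graph on a nonempty finite type. -/
abbrev FinGraph.of {V : Type} [Finite V] [Nonempty V] (G : SimpleGraph V) : FinGraph := ⟨V, G⟩

/-! ### Clique-width -/

/-- Terms over the four operations that construct labelled graphs with labels from a set of size
`k`: create a single vertex with label `i`; take a disjoint union; add all edges between vertices
with label `i` and vertices with label `j` (`i ≠ j`); change every label `i` into `j`. -/
inductive CWTerm (k : ℕ) : Type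
  | vertex (i : Fin k) : CWTerm k
  | union (s t : CWTerm k) : CWTerm k
  | join (i j : Fin k) (hij : i ≠ j) (t : CWTerm k) : CWTerm k
  | relabel (i j : Fin k) (t : CWTerm k) : CWTerm k

namespace CWTerm

/-- The vertex set of the labelled graph constructed by a term. -/
def Vert {k : ℕ} : CWTerm k → Type
  | vertex _ => Unit
  | union s t => s.Vert ⊕ t.Vert
  | join _ _ _ t => t.Vert
  | relabel _ _ t => t.Vert

/-- The labelling of the labelled graph constructed by a term. -/
def label {k : ℕ} : (t : CWTerm k) → t.Vert → Fin k
  | vertex i => fun _ => i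
  | union s t => Sum.elim s.label t.label
  | join _ _ _ t => t.label
  | relabel i j t => fun v => if t.label v = i then j else t.label v

/-- The underlying graph of the labelled graph constructed by a term. -/
def graph {k : ℕ} : (t : CWTerm k) → SimpleGraph t.Vert
  | vertex _ => ⊥
  | union s t => s.graph ⊕g t.graph
  | join i j _ t => t.graph ⊔ SimpleGraph.fromRel (fun u v => t.label u = i ∧ t.label v = j)
  | relabel _ _ t => t.graph

end CWTerm

/-- The clique-width of a graph: the least number of labels of a term that constructs it
(this minimum exists for every nonempty finite graph, see `FinGraph.cliqueWidth_lt_top`). -/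
noncomputable def SimpleGraph.cliqueWidth {V : Type} (G : SimpleGraph V) : ℕ∞ :=
  ⨅ (k : ℕ) (_ : ∃ t : CWTerm k, Nonempty (t.graph ≃g G)), (k : ℕ∞)

/-- Every nonempty finite graph is constructed by some term, so its clique-width is finite. -/
theorem FinGraph.cliqueWidth_lt_top (G : FinGraph) : G.graph.cliqueWidth < ⊤ := by
  classical
  obtain ⟨V, G⟩ := G
  obtain ⟨n, ⟨e⟩⟩ := Finite.exists_equiv_fin V
  have hn : 0 < n := Fin.pos (e (Classical.arbitrary V))
  -- the edgeless graph on the first `m + 1` vertices, labelled injectively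
  have step1 : ∀ m : ℕ, m < n → ∃ t : CWTerm n, t.graph = ⊥ ∧ Function.Injective t.label ∧
      ∀ i : Fin n, i ∈ Set.range t.label ↔ i.val ≤ m := by
    intro m
    induction m with
    | zero =>
      intro h
      refine ⟨.vertex ⟨0, h⟩, rfl, fun a b _ => rfl, fun i => ?_⟩
      constructor
      · rintro ⟨x, rfl⟩
        exact le_refl 0
      · intro hi
        exact ⟨(), Fin.ext (Nat.le_zero.1 hi).symm⟩
    | succ m ih =>
      intro h
      obtain ⟨t, ht, hinj, hr⟩ := ih (by omega)
      have hnot : ∀ x, t.label x ≠ ⟨m + 1, h⟩ := fun x hx => by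
        have := (hr (t.label x)).1 ⟨x, rfl⟩
        rw [hx] at this
        simp at this
      refine ⟨.union t (.vertex ⟨m + 1, h⟩), ?_, ?_, ?_⟩
      · ext u v
        change (t.graph ⊕g (⊥ : SimpleGraph Unit)).Adj u v ↔ False
        rw [ht]
        rcases u with u | u <;> rcases v with v | v <;> simp [SimpleGraph.sum]
      · rintro (u | u) (v | v) huv
        · exact congrArg Sum.inl (hinj huv)
        · exact absurd huv (hnot u)
        · exact absurd huv.symm (hnot v)
        · rfl
      · intro i
        constructor
        · rintro ⟨x | x, rfl⟩
          · exact Nat.le_succ_of_le ((hr _).1 ⟨x, rfl⟩)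
          · exact le_refl (m + 1)
        · intro hi
          rcases Nat.lt_or_ge m i.val with h' | h'
          · exact ⟨.inr (), Fin.ext (show m + 1 = i.val by omega)⟩
          · obtain ⟨x, hx⟩ := (hr i).2 h'
            exact ⟨.inl x, hx⟩
  -- the graph whose edges are the pairs in a given finite set
  have step2 : ∀ S : Finset (Fin n × Fin n), (∀ p ∈ S, p.1 ≠ p.2) →
      ∃ (t : CWTerm n), Function.Bijective t.label ∧
        ∀ u v, t.graph.Adj u v ↔
          ((t.label u, t.label v) ∈ S ∨ (t.label v, t.label u) ∈ S) := by
    intro S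
    induction S using Finset.induction_on with
    | empty =>
      intro _
      obtain ⟨t, ht, hinj, hr⟩ := step1 (n - 1) (by omega)
      refine ⟨t, ⟨hinj, fun i => (hr i).2 (by omega)⟩, fun u v => ?_⟩
      simp [ht]
    | insert p S hp ih =>
      intro h
      obtain ⟨t, hb, hadj⟩ := ih (fun q hq => h q (Finset.mem_insert_of_mem hq))
      have hpne : p.1 ≠ p.2 := h p (Finset.mem_insert_self _ _)
      refine ⟨.join p.1 p.2 hpne t, hb, fun (u v : t.Vert) => ?_⟩
      change (t.graph ⊔ SimpleGraph.fromRel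
        (fun u v => t.label u = p.1 ∧ t.label v = p.2)).Adj u v ↔
        ((t.label u, t.label v) ∈ insert p S ∨ (t.label v, t.label u) ∈ insert p S)
      have hne : ∀ a b, t.label a = p.1 → t.label b = p.2 → a ≠ b :=
        fun a b ha hb' hab => hpne (by rw [← ha, ← hb', hab])
      rw [SimpleGraph.sup_adj, hadj, SimpleGraph.fromRel_adj]
      simp only [Finset.mem_insert, Prod.ext_iff]
      constructor
      · rintro ((h | h) | ⟨_, h | h⟩) <;> tauto
      · rintro ((h | h) | (h | h))
        · exact Or.inr ⟨hne u v h.1 h.2, Or.inl h⟩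
        · tauto
        · exact Or.inr ⟨(hne v u h.1 h.2).symm, Or.inr h⟩
        · tauto
  obtain ⟨t, hb, hadj⟩ := step2
    (Finset.univ.filter fun p => G.Adj (e.symm p.1) (e.symm p.2))
    (fun p hp hpp => by
      rw [Finset.mem_filter, hpp] at hp
      exact G.loopless.irrefl _ hp.2)
  have hiso : Nonempty (t.graph ≃g G) := by
    refine ⟨⟨(Equiv.ofBijective _ hb).trans e.symm, ?_⟩⟩
    intro u v
    simp only [hadj, Finset.mem_filter, Finset.mem_univ, true_and, Equiv.trans_apply,
      Equiv.ofBijective_apply]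
    exact ⟨Or.inl, fun h => h.elim id fun h => h.symm⟩
  exact lt_of_le_of_lt (iInf₂_le n ⟨t, hiso⟩) (ENat.natCast_lt_top n)

/-- A class of graphs has bounded clique-width. -/
def BoundedCliqueWidth (𝒢 : Set FinGraph) : Prop :=
  ∃ c : ℕ, ∀ G ∈ 𝒢, G.graph.cliqueWidth ≤ c

/-- A class of graphs has unbounded clique-width. -/
def UnboundedCliqueWidth (𝒢 : Set FinGraph) : Prop :=
  ¬ BoundedCliqueWidth 𝒢

/-! ### Atoms and forbidden induced subgraphs -/

/-- `K` is a clique cut-set of `G`: a clique whose deletion leaves a disconnected graph, that is,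
a graph with two vertices that no walk joins. -/
def SimpleGraph.IsCliqueCutset {V : Type} (G : SimpleGraph V) (K : Set V) : Prop :=
  G.IsClique K ∧ ¬ (G.induce Kᶜ).Preconnected

/-- `G` has no clique cut-set (the empty set counts as a clique, so such a `G` is connected). -/
def SimpleGraph.IsCliqueAtom {V : Type} (G : SimpleGraph V) : Prop :=
  ∀ K : Set V, ¬ G.IsCliqueCutset K

/-- The class of `𝓗`-free atoms: the atoms that contain no member of `𝓗` as an induced
subgraph. -/
def freeAtoms (𝓗 : Set FinGraph) : Set FinGraph :=
  {G | G.graph.IsCliqueAtom ∧ ∀ H ∈ 𝓗, ¬ H.graph.IsIndContained G.graph}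

/-- The path `P_2` on two vertices. -/
abbrev P2 : SimpleGraph (Fin 2) := SimpleGraph.pathGraph 2

/-- The path `P_5` on five vertices. -/
abbrev P5 : SimpleGraph (Fin 5) := SimpleGraph.pathGraph 5

/-- The cycle `C_4` on four vertices. -/
abbrev C4 : SimpleGraph (Fin 4) := SimpleGraph.cycleGraph 4

/-- The disjoint union `2P_2` of two copies of `P_2`. -/
abbrev twoP2 : SimpleGraph (Fin 2 ⊕ Fin 2) := P2 ⊕g P2

/-- The disjoint union `3P_2` of three copies of `P_2`. -/
abbrev threeP2 : SimpleGraph ((Fin 2 ⊕ Fin 2) ⊕ Fin 2) := twoP2 ⊕g P2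

/-! ### Walls -/

/-- The vertices of the wall of height `k`: the points `(x, y)` with `0 ≤ x ≤ 2k + 1` and
`0 ≤ y ≤ k`, without the two corners that would have degree one, namely `(0, 0)` and the corner
`(0, k)` (for odd `k`) or `(2k + 1, k)` (for even `k`). -/
abbrev WallVertex (k : ℕ) : Type :=
  {p : Fin (2 * k + 2) × Fin (k + 1) //
    ¬ (p.1.val = 0 ∧ p.2.val = 0) ∧
    ¬ (Odd k ∧ p.1.val = 0 ∧ p.2.val = k) ∧
    ¬ (Even k ∧ p.1.val = 2 * k + 1 ∧ p.2.val = k)}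

/-- The wall of height `k`: horizontally consecutive points are adjacent, and `(x, y)` is adjacent
to `(x, y + 1)` whenever `x + y` is odd. For `k ≥ 1` this is a hexagonal grid with `k` rows of
`k` hexagons (bricks) each. -/
def wall (k : ℕ) : SimpleGraph (WallVertex k) :=
  SimpleGraph.fromRel fun u v =>
    (u.1.1.val + 1 = v.1.1.val ∧ u.1.2.val = v.1.2.val) ∨
    (u.1.1.val = v.1.1.val ∧ u.1.2.val + 1 = v.1.2.val ∧ Odd (u.1.1.val + u.1.2.val))

/-- The graph obtained from `G` by making `A` into a clique and adding two non-adjacent vertices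
`Sum.inr false` and `Sum.inr true` that are adjacent to all vertices of `G`. -/
def SimpleGraph.cliqueAddTwins {V : Type} (G : SimpleGraph V) (A : Set V) :
    SimpleGraph (V ⊕ Bool) where
  Adj
    | .inl u, .inl v => G.Adj u v ∨ (u ≠ v ∧ u ∈ A ∧ v ∈ A)
    | .inl _, .inr _ => True
    | .inr _, .inl _ => True
    | .inr _, .inr _ => False
  symm := ⟨by
    rintro (u | u) (v | v) h
    · rcases h with h | ⟨h1, h2, h3⟩
      · exact Or.inl h.symm
      · exact Or.inr ⟨h1.symm, h3, h2⟩
    all_goals trivial⟩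
  loopless := ⟨by
    rintro (u | u) h
    · rcases h with h | h
      · exact G.loopless.irrefl _ h
      · exact h.1 rfl
    · exact h⟩

/-! Unboundedness rests on balanced cuts. The vertices `X` of a subterm over `c` labels split into
at most `c` classes with equal neighbourhoods outside `X`, and a suitable subterm contains more than
`n` but at most `2n` vertices of a prescribed set `W` with more than `2n` members
(`exists_balanced_separatesModules`). In the graph built from a wall, the edges between `A` and its
complement are exactly wall edges, and wall degrees are bounded, so few classes leave few vertices
of `X` with a wall neighbour outside `X`. A wall has no such balanced cut: a set with small boundary
is small or co-small (`wall_ncard_le_of_innerBoundary`).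

Away from the twins the constructed graph is a split graph, hence without induced `2P_2` or `C_4`.
Since the twins are adjacent to everything else, every induced four-cycle has them as a diagonal,
which rules out the complements of `P_5` and `3P_2`.

For the bounded class, take a non-complete `(C_4, P_5)`-free atom. A minimal separator is not a
clique; two non-adjacent vertices in it, joined by short paths on both sides, yield an induced
five-cycle. Relative to this cycle each vertex sees nothing, sees everything, or imitates one cycle
vertex. The vertices that see everything form a clique, so in an atom no vertex sees nothing.
Adjacency is then a function of the patterns on the cycle, and boundedly many types of vertices need
boundedly many labels (`cliqueWidth_le_of_types`). -/

namespace CWTerm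

/-! ### Balanced cuts from clique-width terms -/

instance finite_vert {c : ℕ} : (t : CWTerm c) → Finite t.Vert
  | vertex _ => inferInstanceAs (Finite Unit)
  | union s t =>
    have := finite_vert s
    have := finite_vert t
    inferInstanceAs (Finite (s.Vert ⊕ t.Vert))
  | join _ _ _ t => finite_vert t
  | relabel _ _ t => finite_vert t

lemma graph_join_adj {c : ℕ} {i j : Fin c} {hij : i ≠ j} {t : CWTerm c} (x y : t.Vert) :
    (join i j hij t).graph.Adj x y ↔ t.graph.Adj x y ∨ (x ≠ y ∧
      ((t.label x = i ∧ t.label y = j) ∨ (t.label y = i ∧ t.label x = j))) :=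
  Iff.rfl

lemma label_relabel {c : ℕ} {i j : Fin c} {t : CWTerm c} (x : t.Vert) :
    (relabel i j t).label x = if t.label x = i then j else t.label x :=
  rfl

/-- The map `cl` partitions `X` into classes whose members have the same label and the same
neighbours outside `X`. -/
def SeparatesModules {c : ℕ} (t : CWTerm c) (X : Set t.Vert) (cl : t.Vert → Fin c) : Prop :=
  ∀ x ∈ X, ∀ y ∈ X, cl x = cl y → t.label x = t.label y ∧
    ∀ z ∉ X, (t.graph.Adj x z ↔ t.graph.Adj y z)

lemma ncard_sum {α β : Type*} [Finite α] [Finite β] (W : Set (α ⊕ β)) :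
    W.ncard = (Sum.inl ⁻¹' W).ncard + (Sum.inr ⁻¹' W).ncard := by
  have h1 := Set.ncard_image_of_injective (Sum.inl ⁻¹' W) (Sum.inl_injective (α := α) (β := β))
  have h2 := Set.ncard_image_of_injective (Sum.inr ⁻¹' W) (Sum.inr_injective (α := α) (β := β))
  rw [← h1, ← h2, ← Set.ncard_union_eq]
  · congr 1
    ext (x | x) <;> simp
  · rw [Set.disjoint_left]
    rintro _ ⟨x, _, rfl⟩ ⟨y, _, h⟩
    cases h

/-- A join depends on labels only, and members of one class share their label, so they gain the same
neighbours outside `X`. The classes `cl` are recorded separately from the labels because later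
relabellings may merge labels. -/
lemma separatesModules_join {c : ℕ} {i j : Fin c} {hij : i ≠ j} {t : CWTerm c} {X : Set t.Vert}
    {cl : t.Vert → Fin c} (h : t.SeparatesModules X cl) :
    (join i j hij t).SeparatesModules X cl := by
  intro (x : t.Vert) hx (y : t.Vert) hy hxy
  obtain ⟨h1, h2⟩ := h x hx y hy hxy
  refine ⟨h1, fun (z : t.Vert) hz => ?_⟩
  have hxz : x ≠ z := fun e => hz (e ▸ hx)
  have hyz : y ≠ z := fun e => hz (e ▸ hy)
  refine (graph_join_adj (t := t) x z).trans (Iff.trans ?_ (graph_join_adj (t := t) y z).symm)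
  rw [h2 z hz, h1]
  simp only [hxz, hyz, ne_eq, not_false_eq_true, true_and]

lemma separatesModules_relabel {c : ℕ} {i j : Fin c} {t : CWTerm c} {X : Set t.Vert}
    {cl : t.Vert → Fin c} (h : t.SeparatesModules X cl) :
    (relabel i j t).SeparatesModules X cl := by
  intro x hx y hy hxy
  obtain ⟨h1, h2⟩ := h x hx y hy hxy
  refine ⟨(label_relabel (t := t) x).trans (Eq.trans ?_ (label_relabel (t := t) y).symm), h2⟩
  rw [h1]

/-- The other summand has no edges to `X`. The values of the class map outside `X` are irrelevant.
-/
lemma separatesModules_union_left {c : ℕ} {s t : CWTerm c} {X : Set s.Vert}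
    {cl : s.Vert → Fin c} (h : s.SeparatesModules X cl) :
    (union s t).SeparatesModules (Sum.inl '' X) (Sum.elim cl t.label) := by
  rintro _ ⟨x, hx, rfl⟩ _ ⟨y, hy, rfl⟩ hxy
  obtain ⟨h1, h2⟩ := h x hx y hy hxy
  refine ⟨h1, ?_⟩
  rintro (z | z) hz
  · exact h2 z fun h => hz ⟨z, h, rfl⟩
  · exact Iff.rfl

lemma separatesModules_union_right {c : ℕ} {s t : CWTerm c} {X : Set t.Vert}
    {cl : t.Vert → Fin c} (h : t.SeparatesModules X cl) :
    (union s t).SeparatesModules (Sum.inr '' X) (Sum.elim s.label cl) := by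
  rintro _ ⟨x, hx, rfl⟩ _ ⟨y, hy, rfl⟩ hxy
  obtain ⟨h1, h2⟩ := h x hx y hy hxy
  refine ⟨h1, ?_⟩
  rintro (z | z) hz
  · exact Iff.rfl
  · exact h2 z fun h => hz ⟨z, h, rfl⟩

lemma separatesModules_univ {c : ℕ} (t : CWTerm c) : t.SeparatesModules Set.univ t.label :=
  fun _ _ _ _ h => ⟨h, fun z hz => absurd (Set.mem_univ z) hz⟩

/-- Every set of vertices is cut in a balanced way by some set of vertices that splits into few
classes of vertices with the same outer neighbours. -/
theorem exists_balanced_separatesModules {c n : ℕ} (hn : 0 < n) (t : CWTerm c) (W : Set t.Vert)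
    (hW : 2 * n < W.ncard) :
    ∃ (X : Set t.Vert) (cl : t.Vert → Fin c), t.SeparatesModules X cl ∧
      n < (W ∩ X).ncard ∧ (W ∩ X).ncard ≤ 2 * n := by
  induction t with
  | vertex i =>
    have h : W.ncard ≤ 1 := by
      rw [Set.ncard_le_one_iff]
      exact fun {a b} _ _ => Subsingleton.elim (α := Unit) a b
    omega
  | join i j hij t ih =>
    obtain ⟨X, cl, h, h'⟩ := ih W hW
    exact ⟨X, cl, separatesModules_join h, h'⟩
  | relabel i j t ih =>
    obtain ⟨X, cl, h, h'⟩ := ih W hW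
    exact ⟨X, cl, separatesModules_relabel h, h'⟩
  | union s t ihs iht =>
    change Set (s.Vert ⊕ t.Vert) at W
    have hsum := ncard_sum W
    have hl : ∀ X : Set s.Vert, (W ∩ Sum.inl '' X).ncard = (Sum.inl ⁻¹' W ∩ X).ncard := by
      intro X
      rw [← Set.image_preimage_inter, Set.ncard_image_of_injective _ Sum.inl_injective]
    have hr : ∀ X : Set t.Vert, (W ∩ Sum.inr '' X).ncard = (Sum.inr ⁻¹' W ∩ X).ncard := by
      intro X
      rw [← Set.image_preimage_inter, Set.ncard_image_of_injective _ Sum.inr_injective]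
    by_cases h1 : 2 * n < (Sum.inl ⁻¹' W).ncard
    · obtain ⟨X, cl, h, h'⟩ := ihs _ h1
      refine ⟨Sum.inl '' X, _, separatesModules_union_left h, ?_⟩
      have := hl X
      change n < (W ∩ Sum.inl '' X).ncard ∧ (W ∩ Sum.inl '' X).ncard ≤ 2 * n
      rwa [this]
    by_cases h2 : 2 * n < (Sum.inr ⁻¹' W).ncard
    · obtain ⟨X, cl, h, h'⟩ := iht _ h2
      refine ⟨Sum.inr '' X, _, separatesModules_union_right h, ?_⟩
      have := hr X
      change n < (W ∩ Sum.inr '' X).ncard ∧ (W ∩ Sum.inr '' X).ncard ≤ 2 * n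
      rwa [this]
    -- Neither summand holds more than `2n` members of `W`, but both together do, so one of them
    -- holds more than `n`.
    have hW' : 2 * n < W.ncard := hW
    by_cases h3 : n < (Sum.inl ⁻¹' W).ncard
    · refine ⟨Sum.inl '' Set.univ, _, separatesModules_union_left (separatesModules_univ s), ?_⟩
      have := hl Set.univ
      change n < (W ∩ Sum.inl '' Set.univ).ncard ∧ (W ∩ Sum.inl '' Set.univ).ncard ≤ 2 * n
      rw [this, Set.inter_univ]
      omega
    · refine ⟨Sum.inr '' Set.univ, _, separatesModules_union_right (separatesModules_univ t), ?_⟩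
      have := hr Set.univ
      change n < (W ∩ Sum.inr '' Set.univ).ncard ∧ (W ∩ Sum.inr '' Set.univ).ncard ≤ 2 * n
      rw [this, Set.inter_univ]
      omega

/-! ### Upper bounds on clique-width from vertex types -/

/-- The term `t` constructs the graph with vertex set `s`, adjacency relation `E` and
labelling `l`. -/
def Constructs {c : ℕ} {V : Type} (t : CWTerm c) (s : Set V) (E : V → V → Prop)
    (l : V → Fin c) : Prop :=
  ∃ φ : t.Vert → V, Function.Injective φ ∧ Set.range φ = s ∧ (∀ x, t.label x = l (φ x)) ∧
    ∀ x y, t.graph.Adj x y ↔ E (φ x) (φ y)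

lemma Constructs.congr {c : ℕ} {V : Type} {t : CWTerm c} {s : Set V} {E E' : V → V → Prop}
    {l l' : V → Fin c} (h : t.Constructs s E l) (hE : ∀ x ∈ s, ∀ y ∈ s, (E x y ↔ E' x y))
    (hl : ∀ x ∈ s, l x = l' x) : t.Constructs s E' l' := by
  obtain ⟨φ, h1, rfl, h3, h4⟩ := h
  exact ⟨φ, h1, rfl, fun x => (h3 x).trans (hl _ ⟨x, rfl⟩),
    fun x y => (h4 x y).trans (hE _ ⟨x, rfl⟩ _ ⟨y, rfl⟩)⟩

lemma constructs_vertex {c : ℕ} {V : Type} (i : Fin c) (a : V) :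
    (vertex i).Constructs {a} (fun _ _ => False) (fun _ => i) :=
  ⟨fun _ => a, fun _ _ _ => Subsingleton.elim (α := Unit) _ _, Set.range_const (ι := Unit),
    fun _ => rfl, fun _ _ => Iff.rfl⟩

lemma Constructs.insert_vertex {c : ℕ} {V : Type} {t : CWTerm c} {s : Set V}
    {E : V → V → Prop} {l : V → Fin c} (h : t.Constructs s E l) {a : V} (ha : a ∉ s) :
    (union t (vertex (l a))).Constructs (insert a s)
      (fun x y => x ≠ a ∧ y ≠ a ∧ E x y) l := by
  obtain ⟨φ, h1, rfl, h3, h4⟩ := h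
  have hne : ∀ x, φ x ≠ a := fun x hx => ha ⟨x, hx⟩
  refine ⟨Sum.elim φ fun _ => a, ?_, ?_, ?_, ?_⟩
  · exact h1.sumElim (fun _ _ _ => Subsingleton.elim (α := Unit) _ _) fun x _ => hne x
  · change Set.range (Sum.elim φ fun _ : Unit => a) = _
    rw [Set.Sum.elim_range, Set.range_const, Set.union_singleton]
  · rintro (x | x)
    · exact h3 x
    · rfl
  · rintro (x | x) (y | y)
    · exact (h4 x y).trans (by simp [hne])
    all_goals exact iff_of_false (fun h => nomatch h) fun h => by simp at h

lemma Constructs.join {c : ℕ} {V : Type} {t : CWTerm c} {s : Set V}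
    {E : V → V → Prop} {l : V → Fin c} (h : t.Constructs s E l) {i j : Fin c} (hij : i ≠ j) :
    (join i j hij t).Constructs s
      (fun x y => E x y ∨ (l x = i ∧ l y = j) ∨ (l y = i ∧ l x = j)) l := by
  obtain ⟨φ, h1, h2, h3, h4⟩ := h
  refine ⟨φ, h1, h2, h3, fun (x y : t.Vert) => ?_⟩
  refine (graph_join_adj x y).trans ?_
  simp only [h4, h3]
  refine or_congr_right ⟨fun h => h.2, fun h => ⟨?_, h⟩⟩
  rintro rfl
  rcases h with h | h <;> exact hij (h.1.symm.trans h.2)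

lemma Constructs.relabel {c : ℕ} {V : Type} {t : CWTerm c} {s : Set V}
    {E : V → V → Prop} {l : V → Fin c} (h : t.Constructs s E l) (i j : Fin c) :
    (relabel i j t).Constructs s E (fun x => if l x = i then j else l x) := by
  obtain ⟨φ, h1, h2, h3, h4⟩ := h
  refine ⟨φ, h1, h2, fun (x : t.Vert) => (label_relabel x).trans ?_, h4⟩
  rw [h3]

/-- Joining one label to each label from a finite set. -/
lemma Constructs.join_finset {c : ℕ} {V : Type} {t : CWTerm c} {s : Set V}
    {E : V → V → Prop} {l : V → Fin c} (h : t.Constructs s E l) {i : Fin c} (S : Finset (Fin c))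
    (hS : i ∉ S) :
    ∃ t' : CWTerm c, t'.Constructs s
      (fun x y => E x y ∨ (l x = i ∧ l y ∈ S) ∨ (l y = i ∧ l x ∈ S)) l := by
  induction S using Finset.induction_on with
  | empty => exact ⟨t, h.congr (by simp) (by simp)⟩
  | insert j S hj ih =>
    rw [Finset.mem_insert, not_or] at hS
    obtain ⟨t', ht'⟩ := ih hS.2
    refine ⟨_, (ht'.join hS.1).congr (fun x _ y _ => ?_) (fun _ _ => rfl)⟩
    simp only [Finset.mem_insert]
    tauto

end CWTerm

lemma SimpleGraph.cliqueWidth_le_of_constructs {c : ℕ} {V : Type} {G : SimpleGraph V}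
    {t : CWTerm c} {l : V → Fin c} (h : t.Constructs Set.univ G.Adj l) : G.cliqueWidth ≤ c := by
  obtain ⟨φ, h1, h2, -, h4⟩ := h
  refine iInf₂_le c ⟨t, ⟨⟨Equiv.ofBijective φ ⟨h1, Set.range_eq_univ.1 h2⟩, ?_⟩⟩⟩
  exact fun {x y} => (h4 x y).symm

/-- If the vertices have `k` types such that the adjacency of two distinct vertices depends only on
their types, then the clique-width is at most `k + 1`. -/
theorem SimpleGraph.cliqueWidth_le_of_types {k : ℕ} {V : Type} [Finite V] [Nonempty V]
    {G : SimpleGraph V} (f : V → Fin k) (R : Fin k → Fin k → Prop)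
    (hG : ∀ u v, u ≠ v → (G.Adj u v ↔ R (f u) (f v))) : G.cliqueWidth ≤ (k + 1 : ℕ) := by
  classical
  have key : ∀ s : Finset V, s.Nonempty →
      ∃ t : CWTerm (k + 1), t.Constructs s G.Adj (fun v => (f v).castSucc) := by
    intro s hs
    induction hs using Finset.Nonempty.cons_induction with
    | singleton a =>
      rw [Finset.coe_singleton]
      refine ⟨_, (CWTerm.constructs_vertex (f a).castSucc a).congr ?_ ?_⟩ <;> simp
    | cons a s ha hs ih =>
      obtain ⟨t, ht⟩ := ih
      have ha' : a ∉ (s : Set V) := by simpa using ha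
      -- The spare label `Fin.last k` isolates the new vertex `a` while it is joined to the types
      -- related to its own; afterwards `a` is relabelled to its type and the spare label is free
      -- again.
      let l : V → Fin (k + 1) := fun v => if v = a then Fin.last k else (f v).castSucc
      have ht1 : t.Constructs s G.Adj l := ht.congr (fun _ _ _ _ => Iff.rfl) fun x hx => by
        have : x ≠ a := fun h => ha' (h ▸ hx)
        simp [l, this]
      obtain ⟨t', ht'⟩ := (ht1.insert_vertex ha').join_finset (i := Fin.last k)
        ((Finset.univ.filter fun i => R (f a) i).map Fin.castSuccEmb) (by simp)
      rw [Finset.coe_cons]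
      refine ⟨_, (ht'.relabel (Fin.last k) (f a).castSucc).congr ?_ ?_⟩
      · intro x _ y _
        have hc : ∀ i : Fin k, i.castSucc ≠ Fin.last k := fun i => (Fin.castSucc_lt_last i).ne
        by_cases hx : x = a <;> by_cases hy : y = a
        · subst hx; subst hy
          simp [l]
        · subst hx
          simp [l, hy, hc, hG x y (Ne.symm hy)]
        · subst hy
          simp [l, hx, hc, SimpleGraph.adj_comm G x y, hG y x (Ne.symm hx)]
        · simp [l, hx, hy, hc]
      · intro x _
        by_cases hx : x = a
        · simp [l, hx]
        · simp [l, hx, (Fin.castSucc_lt_last (f x)).ne]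
  have := Fintype.ofFinite V
  obtain ⟨t, ht⟩ := key Finset.univ Finset.univ_nonempty
  rw [Finset.coe_univ] at ht
  exact SimpleGraph.cliqueWidth_le_of_constructs ht

/-! ### Walls: coordinates, degrees and separation -/

lemma wall_adj_iff {k : ℕ} {u v : WallVertex k} : (wall k).Adj u v ↔
    ((u.1.1.val + 1 = v.1.1.val ∧ u.1.2.val = v.1.2.val) ∨
      (u.1.1.val = v.1.1.val ∧ u.1.2.val + 1 = v.1.2.val ∧ Odd (u.1.1.val + u.1.2.val))) ∨
    ((v.1.1.val + 1 = u.1.1.val ∧ v.1.2.val = u.1.2.val) ∨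
      (v.1.1.val = u.1.1.val ∧ v.1.2.val + 1 = u.1.2.val ∧ Odd (v.1.1.val + v.1.2.val))) := by
  rw [wall, SimpleGraph.fromRel_adj]
  refine ⟨fun h => h.2, fun h => ⟨?_, h⟩⟩
  rintro rfl
  omega

lemma WallVertex.eq_of_val {k : ℕ} {u v : WallVertex k} (h1 : u.1.1.val = v.1.1.val)
    (h2 : u.1.2.val = v.1.2.val) : u = v :=
  Subtype.ext (Prod.ext (Fin.ext h1) (Fin.ext h2))

lemma WallVertex.exists_of_val {k x y : ℕ} (hx : x < 2 * k + 2) (hy : y < k + 1)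
    (h1 : ¬ (x = 0 ∧ y = 0)) (h2 : ¬ (k % 2 = 1 ∧ x = 0 ∧ y = k))
    (h3 : ¬ (k % 2 = 0 ∧ x = 2 * k + 1 ∧ y = k)) :
    ∃ u : WallVertex k, u.1.1.val = x ∧ u.1.2.val = y :=
  ⟨⟨(⟨x, hx⟩, ⟨y, hy⟩), h1, by rwa [Nat.odd_iff], by rwa [Nat.even_iff]⟩, rfl, rfl⟩

lemma WallVertex.val_cond {k : ℕ} (u : WallVertex k) :
    u.1.1.val < 2 * k + 2 ∧ u.1.2.val < k + 1 ∧ ¬ (u.1.1.val = 0 ∧ u.1.2.val = 0) ∧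
      ¬ (k % 2 = 1 ∧ u.1.1.val = 0 ∧ u.1.2.val = k) ∧
      ¬ (k % 2 = 0 ∧ u.1.1.val = 2 * k + 1 ∧ u.1.2.val = k) := by
  obtain ⟨⟨x, y⟩, h1, h2, h3⟩ := u
  rw [Nat.odd_iff] at h2
  rw [Nat.even_iff] at h3
  exact ⟨x.2, y.2, h1, h2, h3⟩

theorem wall_isBipartiteWith (k : ℕ) : ∃ A : Set (WallVertex k), (wall k).IsBipartiteWith A Aᶜ := by
  refine ⟨{u | (u.1.1.val + u.1.2.val) % 2 = 0}, disjoint_compl_right, fun v w h => ?_⟩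
  rw [wall_adj_iff] at h
  simp only [Set.mem_compl_iff, Set.mem_ofPred_eq]
  omega

lemma wall_ncard_neighborSet_le {k : ℕ} (z : WallVertex k) :
    {u | (wall k).Adj u z}.ncard ≤ 4 := by
  let g : WallVertex k → ℕ × ℕ := fun u => (u.1.1.val, u.1.2.val)
  have hg : Function.Injective g := fun u v h => by
    rw [Prod.ext_iff] at h
    exact WallVertex.eq_of_val h.1 h.2
  rw [← Set.ncard_image_of_injective _ hg]
  -- All four grid neighbours are allowed, which avoids parity cases. Truncated subtraction at
  -- coordinate zero is harmless, as only an inclusion in `T` is needed.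
  let T : Finset (ℕ × ℕ) := {(z.1.1.val + 1, z.1.2.val), (z.1.1.val - 1, z.1.2.val),
    (z.1.1.val, z.1.2.val + 1), (z.1.1.val, z.1.2.val - 1)}
  have hT : g '' {u | (wall k).Adj u z} ⊆ T := by
    rintro _ ⟨u, hu, rfl⟩
    rw [Set.mem_ofPred_eq, wall_adj_iff] at hu
    simp only [T, g, Finset.coe_insert, Finset.coe_singleton, Set.mem_insert_iff,
      Set.mem_singleton_iff, Prod.mk.injEq]
    omega
  calc _ ≤ (T : Set (ℕ × ℕ)).ncard := Set.ncard_le_ncard hT T.finite_toSet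
    _ = T.card := Set.ncard_coe_finset T
    _ ≤ 4 := Finset.card_le_four

lemma wall_sq_le_card (k : ℕ) : k ^ 2 ≤ Nat.card (WallVertex k) := by
  -- The shift by one avoids `x = 0`, and `x ≤ k` avoids `x = 2k + 1`, so no deleted corner is met.
  have h : ∀ p : Fin k × Fin k, ∃ u : WallVertex k, u.1.1.val = p.1.val + 1 ∧
      u.1.2.val = p.2.val := fun p =>
    WallVertex.exists_of_val (by omega) (by omega) (by omega) (by omega) (by omega)
  choose f h1 h2 using h
  have hf : Function.Injective f := fun p q hpq => by
    have h3 := h1 p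
    have h4 := h2 p
    rw [hpq, h1] at h3
    rw [hpq, h2] at h4
    exact Prod.ext (Fin.ext (by omega)) (Fin.ext h4.symm)
  have := Nat.card_le_card_of_injective f hf
  simpa [sq] using this

/-- The vertices of `X` that have a neighbour outside `X`. -/
def SimpleGraph.innerBoundary {V : Type} (G : SimpleGraph V) (X : Set V) : Set V :=
  {u | u ∈ X ∧ ∃ v ∉ X, G.Adj u v}

lemma SimpleGraph.mem_iff_mem_of_notMem_innerBoundary {V : Type} {G : SimpleGraph V} {X : Set V}
    {u v : V} (hu : u ∉ G.innerBoundary X) (hv : v ∉ G.innerBoundary X) (h : G.Adj u v) :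
    u ∈ X ↔ v ∈ X := by
  constructor
  · intro h1
    by_contra h2
    exact hu ⟨h1, v, h2, h⟩
  · intro h1
    by_contra h2
    exact hv ⟨h1, u, h2, h.symm⟩

lemma wall_row_mem_iff {k : ℕ} {X : Set (WallVertex k)} {y : ℕ}
    (hX : ∀ u : WallVertex k, u.1.2.val = y → u ∉ (wall k).innerBoundary X)
    (u v : WallVertex k) (hu : u.1.2.val = y) (hv : v.1.2.val = y) : u ∈ X ↔ v ∈ X := by
  have key : ∀ d : ℕ, ∀ u v : WallVertex k, u.1.2.val = y → v.1.2.val = y →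
      v.1.1.val = u.1.1.val + d → (u ∈ X ↔ v ∈ X) := by
    intro d
    induction d with
    | zero =>
      intro u v hu hv h
      rw [WallVertex.eq_of_val (u := u) (v := v) (by omega) (by omega)]
    | succ d ih =>
      intro u v hu hv h
      have hu' := u.val_cond
      have hv' := v.val_cond
      obtain ⟨w, hw1, hw2⟩ := WallVertex.exists_of_val (k := k) (x := u.1.1.val + d) (y := y)
        (by omega) (by omega) (by omega) (by omega) (by omega)
      refine (ih u w hu hw2 hw1).trans
        (SimpleGraph.mem_iff_mem_of_notMem_innerBoundary (hX w hw2) (hX v hv) ?_)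
      rw [wall_adj_iff]
      omega
  rcases le_total u.1.1.val v.1.1.val with h | h
  · exact key (v.1.1.val - u.1.1.val) u v hu hv (by omega)
  · exact (key (u.1.1.val - v.1.1.val) v u hv hu (by omega)).symm

/-- The vertices with `x = 2j` or `x = 2j + 1` form a connected ladder-like column: a horizontal
edge joins the two in a row when both exist, and between consecutive rows exactly one of the two
carries a vertical edge. -/
lemma wall_column_mem_iff {k : ℕ} {X : Set (WallVertex k)} {j : ℕ}
    (hX : ∀ u : WallVertex k, u.1.1.val / 2 = j → u ∉ (wall k).innerBoundary X)
    (u v : WallVertex k) (hu : u.1.1.val / 2 = j) (hv : v.1.1.val / 2 = j) : u ∈ X ↔ v ∈ X := by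
  have base : ∀ u v : WallVertex k, u.1.1.val / 2 = j → v.1.1.val / 2 = j →
      v.1.2.val = u.1.2.val → (u ∈ X ↔ v ∈ X) := by
    intro u v hu hv h
    by_cases hx : u.1.1.val = v.1.1.val
    · rw [WallVertex.eq_of_val hx h.symm]
    · refine SimpleGraph.mem_iff_mem_of_notMem_innerBoundary (hX u hu) (hX v hv) ?_
      rw [wall_adj_iff]
      omega
  have key : ∀ d : ℕ, ∀ u v : WallVertex k, u.1.1.val / 2 = j → v.1.1.val / 2 = j →
      v.1.2.val = u.1.2.val + d → (u ∈ X ↔ v ∈ X) := by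
    intro d
    induction d with
    | zero => exact base
    | succ d ih =>
      intro u v hu hv h
      have hu' := u.val_cond
      have hv' := v.val_cond
      -- This `x` is the member of the pair with a vertical edge upwards. Both ends of that edge
      -- exist, since by parity no deleted corner lies on it.
      obtain ⟨x, hx, hodd⟩ : ∃ x, x / 2 = j ∧ (x + (u.1.2.val + d)) % 2 = 1 :=
        ⟨2 * j + (u.1.2.val + d + 1) % 2, by omega, by omega⟩
      obtain ⟨w, hw1, hw2⟩ := WallVertex.exists_of_val (k := k) (x := x) (y := u.1.2.val + d)
        (by omega) (by omega) (by omega) (by omega) (by omega)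
      obtain ⟨w', hw1', hw2'⟩ := WallVertex.exists_of_val (k := k) (x := x)
        (y := u.1.2.val + d + 1) (by omega) (by omega) (by omega) (by omega) (by omega)
      refine (ih u w hu (by omega) hw2).trans (Iff.trans ?_ (base w' v (by omega) hv (by omega)))
      refine SimpleGraph.mem_iff_mem_of_notMem_innerBoundary (hX w (by omega)) (hX w' (by omega)) ?_
      rw [wall_adj_iff]
      simp only [Nat.odd_iff]
      omega
  rcases le_total u.1.2.val v.1.2.val with h | h
  · exact key (v.1.2.val - u.1.2.val) u v hu hv (by omega)
  · exact (key (u.1.2.val - v.1.2.val) v u hv hu (by omega)).symm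

lemma exists_lt_notMem_of_ncard_lt {m n : ℕ} {S : Set ℕ} (hS : S.Finite) (h : S.ncard ≤ m)
    (hm : m < n) : ∃ i < n, i ∉ S := by
  by_contra! hc
  have h1 : ((Finset.range n : Finset ℕ) : Set ℕ) ⊆ S := fun i hi => hc i (by simpa using hi)
  have h2 := Set.ncard_le_ncard h1 hS
  rw [Set.ncard_coe_finset, Finset.card_range] at h2
  omega

/-- A vertex set with small boundary in the wall is small or co-small. -/
theorem wall_ncard_le_of_innerBoundary {k m : ℕ} (hk : 0 < k) (hm : m < k + 1) (X : Set (WallVertex k))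
    (hX : ((wall k).innerBoundary X).ncard ≤ m) : X.ncard ≤ 2 * m ^ 2 ∨ Xᶜ.ncard ≤ 2 * m ^ 2 := by
  set R : Set ℕ := (fun u : WallVertex k => u.1.2.val) '' (wall k).innerBoundary X with hR
  set C : Set ℕ := (fun u : WallVertex k => u.1.1.val / 2) '' (wall k).innerBoundary X with hC
  have hRf : R.Finite := Set.toFinite _
  have hCf : C.Finite := Set.toFinite _
  have hRm : R.ncard ≤ m := (Set.ncard_image_le (Set.toFinite _)).trans hX
  have hCm : C.ncard ≤ m := (Set.ncard_image_le (Set.toFinite _)).trans hX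
  have hrow : ∀ y ∉ R, ∀ u v : WallVertex k, u.1.2.val = y → v.1.2.val = y → (u ∈ X ↔ v ∈ X) :=
    fun y hy => wall_row_mem_iff fun u hu hb => hy ⟨u, hb, hu⟩
  have hcol : ∀ j ∉ C, ∀ u v : WallVertex k, u.1.1.val / 2 = j → v.1.1.val / 2 = j →
      (u ∈ X ↔ v ∈ X) :=
    fun j hj => wall_column_mem_iff fun u hu hb => hj ⟨u, hb, hu⟩
  have hcross : ∀ j < k + 1, ∀ y < k + 1, ∃ u : WallVertex k, u.1.1.val / 2 = j ∧
      u.1.2.val = y := by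
    intro j hj y hy
    -- The point with odd `x = 2j + 1` serves unless it is the deleted corner `(2k + 1, k)`.
    by_cases h : k % 2 = 0 ∧ j = k ∧ y = k
    · obtain ⟨u, h1, h2⟩ := WallVertex.exists_of_val (k := k) (x := 2 * j) (y := y)
        (by omega) (by omega) (by omega) (by omega) (by omega)
      exact ⟨u, by omega, h2⟩
    · obtain ⟨u, h1, h2⟩ := WallVertex.exists_of_val (k := k) (x := 2 * j + 1) (y := y)
        (by omega) (by omega) (by omega) (by omega) (by omega)
      exact ⟨u, by omega, h2⟩
  obtain ⟨y₀, hy₀, hy₀R⟩ := exists_lt_notMem_of_ncard_lt hRf hRm hm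
  obtain ⟨j₀, hj₀, hj₀C⟩ := exists_lt_notMem_of_ncard_lt hCf hCm hm
  obtain ⟨p, hpj, hpy⟩ := hcross j₀ hj₀ y₀ hy₀
  -- Some row and some column avoid the boundary; they meet at `p`. Any other boundary-free row or
  -- column meets one of these two and so lies on the side of `p`.
  have hgood : ∀ v : WallVertex k, v.1.2.val ∉ R ∨ v.1.1.val / 2 ∉ C → (v ∈ X ↔ p ∈ X) := by
    intro v hv
    have hv' := v.val_cond
    rcases hv with hv | hv
    · obtain ⟨q, hqj, hqy⟩ := hcross j₀ hj₀ v.1.2.val hv'.2.1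
      exact (hrow _ hv v q rfl hqy).trans (hcol _ hj₀C q p hqj hpj)
    · obtain ⟨q, hqj, hqy⟩ := hcross (v.1.1.val / 2) (by omega) y₀ hy₀
      exact (hcol _ hv v q rfl hqj).trans (hrow _ hy₀R q p hqy hpy)
  -- A vertex on the other side lies in one of at most `m` rows and one of at most `m` columns that
  -- meet the boundary, and a row and a column share at most two vertices.
  have hsmall : ∀ D : Set (WallVertex k), (∀ v ∈ D, ¬ (v ∈ X ↔ p ∈ X)) →
      D.ncard ≤ 2 * m ^ 2 := by
    intro D hD
    let g : WallVertex k → ℕ × ℕ × ℕ := fun u => (u.1.1.val % 2, u.1.1.val / 2, u.1.2.val)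
    have hg : Function.Injective g := fun u v h => by
      simp only [g, Prod.mk.injEq] at h
      exact WallVertex.eq_of_val (by omega) h.2.2
    have hsub : g '' D ⊆ ((Finset.range 2 : Finset ℕ) : Set ℕ) ×ˢ C ×ˢ R := by
      rintro _ ⟨v, hv, rfl⟩
      have h1 := hD v hv
      refine ⟨?_, ?_, ?_⟩
      · simpa [g] using Nat.mod_lt _ two_pos
      · by_contra h
        exact h1 (hgood v (Or.inr h))
      · by_contra h
        exact h1 (hgood v (Or.inl h))
    rw [← Set.ncard_image_of_injective _ hg]
    calc (g '' D).ncard ≤ _ := Set.ncard_le_ncard hsub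
          ((Finset.finite_toSet _).prod (hCf.prod hRf))
      _ = 2 * (C.ncard * R.ncard) := by
          rw [Set.ncard_prod, Set.ncard_prod, Set.ncard_coe_finset, Finset.card_range]
      _ ≤ 2 * m ^ 2 := by
          rw [sq]
          gcongr
  by_cases hp : p ∈ X
  · exact Or.inr (hsmall _ fun v hv h => hv (h.2 hp))
  · exact Or.inl (hsmall _ fun v hv h => hp (h.1 hv))

/-! ### Unbounded clique-width of the graphs built from walls -/

/-- The number of vertices on the inner boundary of a set that splits into `c` modules. -/
lemma ncard_innerBoundary_le {k c : ℕ} {A : Set (WallVertex k)}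
    (hA : (wall k).IsBipartiteWith A Aᶜ) (X : Set (WallVertex k)) (cl : WallVertex k → Fin c)
    (hcl : ∀ x ∈ X, ∀ y ∈ X, cl x = cl y → ∀ z ∉ X,
      (((wall k).cliqueAddTwins A).Adj (.inl x) (.inl z) ↔
        ((wall k).cliqueAddTwins A).Adj (.inl y) (.inl z))) :
    ((wall k).innerBoundary X).ncard ≤ 8 * c := by
  classical
  have hadj : ∀ x z, (x ∈ A ↔ z ∉ A) →
      (((wall k).cliqueAddTwins A).Adj (.inl x) (.inl z) ↔ (wall k).Adj x z) := by
    intro x z h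
    change (_ ∨ _) ↔ _
    tauto
  have hside : ∀ x z, (wall k).Adj x z → (x ∈ A ↔ z ∉ A) := by
    intro x z h
    have := hA.mem_of_adj h
    simp only [Set.mem_compl_iff] at this
    tauto
  have hfin := Set.toFinite ((wall k).innerBoundary X)
  rw [Set.ncard_eq_toFinset_card _ hfin]
  -- Splitting the classes further by the side of `A` gives at most `2c` parts. Within a part, a
  -- wall neighbour `z` outside `X` of one member is a wall neighbour of all members, because making
  -- `A` a clique adds no edges between the sides; so each part has at most four boundary vertices.
  refine (Finset.card_le_mul_card_image_of_maps_to (t := Finset.univ)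
    (f := fun u => (cl u, decide (u ∈ A))) (fun _ _ => Finset.mem_univ _) 4 ?_).trans ?_
  · intro b _
    rcases Finset.eq_empty_or_nonempty
      (hfin.toFinset.filter fun u => (cl u, decide (u ∈ A)) = b) with h | ⟨u, hu⟩
    · rw [h]
      simp
    rw [Finset.mem_filter, Set.Finite.mem_toFinset] at hu
    obtain ⟨⟨huX, z, hz, huz⟩, rfl⟩ := hu
    rw [← Set.ncard_coe_finset]
    refine (Set.ncard_le_ncard ?_ (Set.toFinite _)).trans (wall_ncard_neighborSet_le z)
    intro v hv
    rw [Finset.mem_coe, Finset.mem_filter, Set.Finite.mem_toFinset, Prod.mk.injEq,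
      decide_eq_decide] at hv
    obtain ⟨⟨hvX, -⟩, hv1, hv2⟩ := hv
    have hs := hside u z huz
    exact (hadj v z (hv2.trans hs)).1 ((hcl v hvX u huX hv1 z hz).2 ((hadj u z hs).2 huz))
  · simp only [Finset.card_univ, Fintype.card_prod, Fintype.card_fin, Fintype.card_bool]
    omega

/-- No term over `c` labels constructs the graph obtained from a high wall. -/
theorem cliqueAddTwins_wall_not_constructed {k c : ℕ} (hk : 3 * (8 * c + 1) ≤ k)
    {A : Set (WallVertex k)} (hA : (wall k).IsBipartiteWith A Aᶜ) (t : CWTerm c)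
    (e : t.graph ≃g (wall k).cliqueAddTwins A) : False := by
  set m := 8 * c + 1 with hm
  let φ : WallVertex k → t.Vert := fun u => e.symm (.inl u)
  have hφ : Function.Injective φ := fun u v h => Sum.inl_injective (e.symm.injective h)
  have hadj : ∀ u v, t.graph.Adj (φ u) (φ v) ↔
      ((wall k).cliqueAddTwins A).Adj (.inl u) (.inl v) := fun u v => e.symm.map_rel_iff
  have hN := wall_sq_le_card k
  have hkm : (3 * m) ^ 2 ≤ k ^ 2 := Nat.pow_le_pow_left hk 2
  have hm0 : 0 < m ^ 2 := by positivity
  have hsq : (3 * m) ^ 2 = 9 * m ^ 2 := by ring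
  have hW : (Set.range φ).ncard = Nat.card (WallVertex k) := by
    rw [← Set.image_univ, Set.ncard_image_of_injective _ hφ, Set.ncard_univ]
  -- The wall has at least `9m²` vertices. The cut contains more than `2m²` and at most `4m²` of
  -- them, leaving at least `5m²` outside, so it is neither small nor co-small.
  obtain ⟨X, cl, hX, h1, h2⟩ := t.exists_balanced_separatesModules (n := 2 * m ^ 2) (by omega)
    (Set.range φ) (by omega)
  have hX' : (Set.range φ ∩ X).ncard = (φ ⁻¹' X).ncard := by
    rw [← Set.image_univ, ← Set.image_inter_preimage, Set.univ_inter,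
      Set.ncard_image_of_injective _ hφ]
  have hb := ncard_innerBoundary_le hA (φ ⁻¹' X) (fun u => cl (φ u)) fun x hx y hy hxy z hz => by
    rw [← hadj, ← hadj]
    exact (hX _ hx _ hy hxy).2 _ hz
  have hc := Set.ncard_add_ncard_compl (φ ⁻¹' X)
  rcases wall_ncard_le_of_innerBoundary (m := m) (by omega) (by omega) (φ ⁻¹' X)
    (hb.trans (Nat.le_succ _)) with h | h <;>
    omega

lemma SimpleGraph.exists_term_of_cliqueWidth_le {V : Type} {G : SimpleGraph V} {c : ℕ}
    (h : G.cliqueWidth ≤ c) : ∃ k ≤ c, ∃ t : CWTerm k, Nonempty (t.graph ≃g G) := by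
  by_contra! hc
  have : ((c + 1 : ℕ) : ℕ∞) ≤ G.cliqueWidth := by
    refine le_iInf₂ fun k hk => ?_
    obtain ⟨t, ht⟩ := hk
    have : ¬ k ≤ c := fun hkc => (hc k hkc t).false ht.some
    exact_mod_cast (by omega : c + 1 ≤ k)
  have h' := this.trans h
  norm_cast at h'
  omega

theorem unboundedCliqueWidth_cliqueAddTwins_wall (A : (k : ℕ) → Set (WallVertex k))
    (hA : ∀ k : ℕ, 2 ≤ k → (wall k).IsBipartiteWith (A k) (A k)ᶜ) :
    UnboundedCliqueWidth
      {G | ∃ k : ℕ, 2 ≤ k ∧ G = FinGraph.of ((wall k).cliqueAddTwins (A k))} := by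
  rintro ⟨c, hc⟩
  obtain ⟨c', hc', t, ⟨e⟩⟩ := SimpleGraph.exists_term_of_cliqueWidth_le
    (hc _ ⟨3 * (8 * c + 1), by omega, rfl⟩)
  exact cliqueAddTwins_wall_not_constructed (by omega) (hA _ (by omega)) t e

/-! ### Forbidden induced subgraphs and clique cut-sets in the constructed graphs -/

namespace SimpleGraph

variable {V : Type} {G : SimpleGraph V} {A : Set V}

@[simp] lemma cliqueAddTwins_adj_inl_inl {u v : V} : (G.cliqueAddTwins A).Adj (.inl u) (.inl v) ↔
    G.Adj u v ∨ (u ≠ v ∧ u ∈ A ∧ v ∈ A) := Iff.rfl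

@[simp] lemma cliqueAddTwins_adj_inl_inr {u : V} {i : Bool} :
    (G.cliqueAddTwins A).Adj (.inl u) (.inr i) := trivial

@[simp] lemma cliqueAddTwins_adj_inr_inl {u : V} {i : Bool} :
    (G.cliqueAddTwins A).Adj (.inr i) (.inl u) := trivial

@[simp] lemma cliqueAddTwins_adj_inr_inr {i j : Bool} :
    ¬ (G.cliqueAddTwins A).Adj (.inr i) (.inr j) := fun h => h

lemma IsBipartiteWith.mem_iff_notMem (hA : G.IsBipartiteWith A Aᶜ) {u v : V} (h : G.Adj u v) :
    u ∈ A ↔ v ∉ A := by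
  have := hA.mem_of_adj h
  simp only [Set.mem_compl_iff] at this
  tauto

/-- An edge cannot consist of both twins, so a twin is adjacent to an end of every edge avoiding it.
Without twins, each edge meets the clique `A`, so two edges share a vertex or are linked by an edge.
-/
lemma not_twoP2_isIndContained_cliqueAddTwins (hA : G.IsBipartiteWith A Aᶜ) :
    ¬ twoP2.IsIndContained (G.cliqueAddTwins A) := by
  rintro ⟨f⟩
  have h1 : (G.cliqueAddTwins A).Adj (f (.inl 0)) (f (.inl 1)) :=
    f.map_rel_iff.2 (by simp [SimpleGraph.sum, pathGraph_adj])
  have h2 : (G.cliqueAddTwins A).Adj (f (.inr 0)) (f (.inr 1)) :=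
    f.map_rel_iff.2 (by simp [SimpleGraph.sum, pathGraph_adj])
  have h3 : ∀ i j, ¬ (G.cliqueAddTwins A).Adj (f (.inl i)) (f (.inr j)) := fun i j h =>
    absurd (f.map_rel_iff.1 h) (by simp [SimpleGraph.sum])
  have h4 : ∀ i j, f (.inl i) ≠ f (.inr j) := fun i j h => by simpa using f.injective h
  have a1 := h3 0 0
  have a2 := h3 0 1
  have a3 := h3 1 0
  have a4 := h3 1 1
  have b1 := h4 0 0
  have b2 := h4 0 1
  have b3 := h4 1 0
  have b4 := h4 1 1
  clear h3 h4
  generalize f (.inl 0) = a at *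
  generalize f (.inl 1) = b at *
  generalize f (.inr 0) = c at *
  generalize f (.inr 1) = d at *
  have hs := fun u v => hA.mem_iff_notMem (u := u) (v := v)
  rcases a with a | a <;> rcases b with b | b <;> rcases c with c | c <;> rcases d with d | d <;>
    simp at *
  grind

/-- A four-cycle `a c b d` of the graph contains both twins. -/
lemma twins_of_fourCycle_cliqueAddTwins (hA : G.IsBipartiteWith A Aᶜ) {a b c d : V ⊕ Bool}
    (hab : a ≠ b) (hcd : c ≠ d) (hab' : ¬ (G.cliqueAddTwins A).Adj a b)
    (hcd' : ¬ (G.cliqueAddTwins A).Adj c d) (hac : (G.cliqueAddTwins A).Adj a c)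
    (had : (G.cliqueAddTwins A).Adj a d) (hbc : (G.cliqueAddTwins A).Adj b c)
    (hbd : (G.cliqueAddTwins A).Adj b d) :
    (∃ i j, a = .inr i ∧ b = .inr j) ∨ (∃ i j, c = .inr i ∧ d = .inr j) := by
  -- The only non-neighbour of a twin is the other twin. Without twins, each non-adjacent pair has a
  -- member outside `A`; two such members, one from each diagonal, would be adjacent, but the
  -- complement of `A` is independent.
  have hs := fun u v => hA.mem_iff_notMem (u := u) (v := v)
  rcases a with a | a <;> rcases b with b | b <;> rcases c with c | c <;> rcases d with d | d <;>
    simp at *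
  grind

lemma adj_of_ne_twins {a b c : V ⊕ Bool} (ha : ∃ i j, a = .inr i ∧ b = .inr j) (hab : a ≠ b)
    (hac : a ≠ c) (hbc : b ≠ c) : (G.cliqueAddTwins A).Adj a c ∧ (G.cliqueAddTwins A).Adj b c := by
  obtain ⟨i, j, rfl, rfl⟩ := ha
  rcases c with c | c
  · exact ⟨trivial, trivial⟩
  · simp only [ne_eq, Sum.inr.injEq] at hab hac hbc
    have : ∀ i j c : Bool, ¬ i = j → ¬ i = c → ¬ j = c → False := by decide
    exact (this i j c hab hac hbc).elim

lemma not_coP5_isIndContained_cliqueAddTwins (hA : G.IsBipartiteWith A Aᶜ) :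
    ¬ P5ᶜ.IsIndContained (G.cliqueAddTwins A) := by
  rintro ⟨f⟩
  have h1 : ∀ i j, P5ᶜ.Adj i j → (G.cliqueAddTwins A).Adj (f i) (f j) := fun i j h =>
    f.map_rel_iff.2 h
  have h2 : ∀ i j, ¬ P5ᶜ.Adj i j → ¬ (G.cliqueAddTwins A).Adj (f i) (f j) := fun i j h h' =>
    h (f.map_rel_iff.1 h')
  have h3 : ∀ i j, i ≠ j → f i ≠ f j := fun i j h h' => h (f.injective h')
  simp only [compl_adj, pathGraph_adj] at h1 h2
  -- In the complement of the path, `0, 1` and `3, 4` are the diagonals of a four-cycle, and vertex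
  -- `2` is non-adjacent to a vertex of each, namely `1` and `3`.
  rcases twins_of_fourCycle_cliqueAddTwins hA (h3 0 1 (by decide)) (h3 3 4 (by decide))
    (h2 0 1 (by decide)) (h2 3 4 (by decide)) (h1 0 3 (by decide)) (h1 0 4 (by decide))
    (h1 1 3 (by decide)) (h1 1 4 (by decide)) with h | h
  · exact h2 1 2 (by decide) (adj_of_ne_twins h (h3 0 1 (by decide)) (h3 0 2 (by decide))
      (h3 1 2 (by decide))).2
  · exact h2 3 2 (by decide) (adj_of_ne_twins h (h3 3 4 (by decide)) (h3 3 2 (by decide))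
      (h3 4 2 (by decide))).1

lemma coThreeP2_adj_iff (x y : (Fin 2 ⊕ Fin 2) ⊕ Fin 2) : threeP2ᶜ.Adj x y ↔
    (Sum.elim (Sum.elim (fun _ => 0) fun _ => 1) (fun _ => 2) x : Fin 3) ≠
      Sum.elim (Sum.elim (fun _ => 0) fun _ => 1) (fun _ => 2) y := by
  have hP : ∀ x y : Fin 2, ¬ (¬ x = y ∧ ¬ P2.Adj x y) := by
    simp only [pathGraph_adj]
    decide
  rcases x with (x | x) | x <;> rcases y with (y | y) | y <;> simp [SimpleGraph.sum] <;>
    simpa using hP x y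

/-- The complement of `3P_2` is complete tripartite with parts of size two. Any two parts form a
four-cycle, so at least two of the three parts would be the pair of twins. -/
lemma not_coThreeP2_isIndContained_cliqueAddTwins (hA : G.IsBipartiteWith A Aᶜ) :
    ¬ threeP2ᶜ.IsIndContained (G.cliqueAddTwins A) := by
  rintro ⟨f⟩
  have h1 : ∀ i j, threeP2ᶜ.Adj i j → (G.cliqueAddTwins A).Adj (f i) (f j) := fun i j h =>
    f.map_rel_iff.2 h
  have h2 : ∀ i j, ¬ threeP2ᶜ.Adj i j → ¬ (G.cliqueAddTwins A).Adj (f i) (f j) := fun i j h h' =>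
    h (f.map_rel_iff.1 h')
  have h3 : ∀ i j, i ≠ j → f i ≠ f j := fun i j h h' => h (f.injective h')
  let g : (Fin 2 ⊕ Fin 2) ⊕ Fin 2 → Fin 3 := Sum.elim (Sum.elim (fun _ => 0) fun _ => 1) fun _ => 2
  have hg : ∀ x y, threeP2ᶜ.Adj x y ↔ g x ≠ g y := coThreeP2_adj_iff
  have key : ∀ a b c d, g a = g b → a ≠ b → g c = g d → c ≠ d → g a ≠ g c →
      (∃ i j, f a = .inr i ∧ f b = .inr j) ∨ (∃ i j, f c = .inr i ∧ f d = .inr j) := by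
    intro a b c d hab hab' hcd hcd' hac
    refine twins_of_fourCycle_cliqueAddTwins hA (h3 _ _ hab') (h3 _ _ hcd')
      (h2 _ _ ?_) (h2 _ _ ?_) (h1 _ _ ?_) (h1 _ _ ?_) (h1 _ _ ?_) (h1 _ _ ?_) <;>
      simp [hg, ← hab, ← hcd, hac]
  have excl : ∀ a b c d, a ≠ b → a ≠ c → b ≠ c → (∃ i j, f a = .inr i ∧ f b = .inr j) →
      ¬ (∃ i j, f c = .inr i ∧ f d = .inr j) := by
    rintro a b c d hab hac hbc h ⟨i, j, hi, -⟩
    have h4 := (adj_of_ne_twins (G := G) (A := A) h (h3 _ _ hab) (h3 _ _ hac) (h3 _ _ hbc)).1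
    obtain ⟨i', j', hi', -⟩ := h
    rw [hi', hi] at h4
    exact h4
  let x : Fin 2 → (Fin 2 ⊕ Fin 2) ⊕ Fin 2 := fun i => .inl (.inl i)
  let y : Fin 2 → (Fin 2 ⊕ Fin 2) ⊕ Fin 2 := fun i => .inl (.inr i)
  let z : Fin 2 → (Fin 2 ⊕ Fin 2) ⊕ Fin 2 := fun i => .inr i
  have k1 := key (x 0) (x 1) (y 0) (y 1) rfl (by decide) rfl (by decide) (by decide)
  have k2 := key (x 0) (x 1) (z 0) (z 1) rfl (by decide) rfl (by decide) (by decide)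
  have k3 := key (y 0) (y 1) (z 0) (z 1) rfl (by decide) rfl (by decide) (by decide)
  have e1 := excl (x 0) (x 1) (y 0) (y 1) (by decide) (by decide) (by decide)
  have e2 := excl (x 0) (x 1) (z 0) (z 1) (by decide) (by decide) (by decide)
  have e3 := excl (y 0) (y 1) (z 0) (z 1) (by decide) (by decide) (by decide)
  rcases k1 with h | h
  · exact k3.elim (e1 h) (e2 h)
  · exact k2.elim (fun h' => e1 h' h) (e3 h)

/-- A clique misses a twin and one of `b₁`, `b₂`. The remaining twin is adjacent to all remaining
vertices of `G`, and a remaining `b` links it to the other twin. -/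
lemma isCliqueAtom_cliqueAddTwins (hA : G.IsBipartiteWith A Aᶜ) {b₁ b₂ : V} (hb : b₁ ≠ b₂)
    (h₁ : b₁ ∉ A) (h₂ : b₂ ∉ A) : (G.cliqueAddTwins A).IsCliqueAtom := by
  rintro K ⟨hK, hcon⟩
  have hadj : ¬ (G.cliqueAddTwins A).Adj (.inl b₁) (.inl b₂) := by
    rintro (h | h)
    · exact h₁ ((hA.mem_iff_notMem h).2 h₂)
    · exact h₁ h.2.1
  obtain ⟨b, hbK⟩ : ∃ b, Sum.inl b ∉ K := by
    by_contra! hc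
    exact hadj (hK (hc b₁) (hc b₂) (by simpa using hb))
  obtain ⟨i, hi⟩ : ∃ i, Sum.inr i ∉ K := by
    by_contra! hc
    exact hK (hc false) (hc true) (by simp)
  have hreach : ∀ p : ↥(Kᶜ), ((G.cliqueAddTwins A).induce Kᶜ).Reachable ⟨.inr i, hi⟩ p := by
    rintro ⟨v | j, hp⟩
    · exact Adj.reachable (by exact trivial)
    · have a1 : ((G.cliqueAddTwins A).induce Kᶜ).Adj ⟨.inr i, hi⟩ ⟨.inl b, hbK⟩ := trivial
      have a2 : ((G.cliqueAddTwins A).induce Kᶜ).Adj ⟨.inl b, hbK⟩ ⟨.inr j, hp⟩ := trivial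
      exact a1.reachable.trans a2.reachable
  exact hcon fun p q => (hreach p).symm.trans (hreach q)

end SimpleGraph

/-- For `k ≥ 2`, row 1 is neither the bottom nor the top row, so it has no deleted corner. Its first
four vertices form a path that alternates between the sides. -/
lemma exists_two_notMem_wall {k : ℕ} (hk : 2 ≤ k) {A : Set (WallVertex k)}
    (hA : (wall k).IsBipartiteWith A Aᶜ) : ∃ b₁ b₂, b₁ ≠ b₂ ∧ b₁ ∉ A ∧ b₂ ∉ A := by
  have hrow : ∀ x : Fin 4, ∃ u : WallVertex k, u.1.1.val = x.val ∧ u.1.2.val = 1 := fun x =>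
    WallVertex.exists_of_val (by omega) (by omega) (by omega) (by omega) (by omega)
  choose f h1 h2 using hrow
  have hadj : ∀ x y : Fin 4, x.val + 1 = y.val → (f x ∈ A ↔ f y ∉ A) := fun x y h =>
    hA.mem_iff_notMem (wall_adj_iff.2 (Or.inl (Or.inl ⟨by rw [h1, h1, h], by rw [h2, h2]⟩)))
  have hne : ∀ x y : Fin 4, x ≠ y → f x ≠ f y := fun x y h h' => h (Fin.ext (by
    rw [← h1, ← h1, h']))
  have a1 := hadj 0 1 rfl
  have a2 := hadj 1 2 rfl
  have a3 := hadj 2 3 rfl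
  by_cases h : f 0 ∈ A
  · exact ⟨f 1, f 3, hne _ _ (by decide), by tauto, by tauto⟩
  · exact ⟨f 0, f 2, hne _ _ (by decide), by tauto, by tauto⟩

theorem cliqueAddTwins_wall_mem_freeAtoms {k : ℕ} (hk : 2 ≤ k) {A : Set (WallVertex k)}
    (hA : (wall k).IsBipartiteWith A Aᶜ) [Nonempty (WallVertex k ⊕ Bool)] :
    FinGraph.of ((wall k).cliqueAddTwins A) ∈
      freeAtoms {.of twoP2, .of P5ᶜ, .of threeP2ᶜ} := by
  obtain ⟨b₁, b₂, hb, h₁, h₂⟩ := exists_two_notMem_wall hk hA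
  refine ⟨SimpleGraph.isCliqueAtom_cliqueAddTwins hA hb h₁ h₂, ?_⟩
  rintro H (rfl | rfl | rfl)
  · exact SimpleGraph.not_twoP2_isIndContained_cliqueAddTwins hA
  · exact SimpleGraph.not_coP5_isIndContained_cliqueAddTwins hA
  · exact SimpleGraph.not_coThreeP2_isIndContained_cliqueAddTwins hA

lemma UnboundedCliqueWidth.mono {𝒢 ℋ : Set FinGraph} (h : UnboundedCliqueWidth 𝒢) (hs : 𝒢 ⊆ ℋ) :
    UnboundedCliqueWidth ℋ :=
  fun ⟨c, hc⟩ => h ⟨c, fun G hG => hc G (hs hG)⟩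

theorem unboundedCliqueWidth_freeAtoms :
    UnboundedCliqueWidth (freeAtoms {.of twoP2, .of P5ᶜ, .of threeP2ᶜ}) := by
  choose A hA using wall_isBipartiteWith
  refine (unboundedCliqueWidth_cliqueAddTwins_wall A fun k _ => hA k).mono ?_
  rintro _ ⟨k, hk, rfl⟩
  exact cliqueAddTwins_wall_mem_freeAtoms hk (hA k)

lemma twoP2_isIndContained_coC4 : twoP2.IsIndContained C4ᶜ := by
  refine ⟨⟨⟨Sum.elim ![0, 2] ![1, 3], by decide⟩, ?_⟩⟩
  rintro (a | a) (b | b) <;> fin_cases a <;> fin_cases b <;>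
    simp [SimpleGraph.sum, SimpleGraph.pathGraph_adj, SimpleGraph.cycleGraph_adj'] <;> decide

theorem unboundedCliqueWidth_freeAtoms_coC4 :
    UnboundedCliqueWidth (freeAtoms {.of C4ᶜ, .of P5ᶜ}) := by
  refine unboundedCliqueWidth_freeAtoms.mono ?_
  rintro G ⟨h1, h2⟩
  refine ⟨h1, ?_⟩
  rintro H (rfl | rfl)
  · exact fun h => h2 (.of twoP2) (by simp) (twoP2_isIndContained_coC4.trans h)
  · exact h2 _ (by simp)

/-! ### Induced five-cycles in `(C_4, P_5)`-free atoms -/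

namespace SimpleGraph

variable {V : Type} {G : SimpleGraph V}

lemma C4_isIndContained_of_adj {a b c d : V} (hab : G.Adj a b) (hbc : G.Adj b c) (hcd : G.Adj c d)
    (hda : G.Adj d a) (hac : ¬ G.Adj a c) (hbd : ¬ G.Adj b d) (nac : a ≠ c) (nbd : b ≠ d) :
    C4.IsIndContained G := by
  have n1 := hab.ne
  have n2 := hbc.ne
  have n3 := hcd.ne
  have n4 := hda.ne
  refine ⟨⟨⟨![a, b, c, d], ?_⟩, ?_⟩⟩
  · intro i j h
    fin_cases i <;> fin_cases j <;> simp_all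
  · intro i j
    change G.Adj (![a, b, c, d] i) (![a, b, c, d] j) ↔ _
    rw [cycleGraph_adj']
    fin_cases i <;> fin_cases j <;>
      simp [hab, hbc, hcd, hda, hac, hbd, hab.symm, hbc.symm, hcd.symm, hda.symm,
        G.adj_comm c a, G.adj_comm d b] <;> decide

lemma P5_isIndContained_of_adj {a b c d e : V} (hab : G.Adj a b) (hbc : G.Adj b c)
    (hcd : G.Adj c d) (hde : G.Adj d e) (hac : ¬ G.Adj a c) (had : ¬ G.Adj a d) (hae : ¬ G.Adj a e)
    (hbd : ¬ G.Adj b d) (hbe : ¬ G.Adj b e) (hce : ¬ G.Adj c e) : P5.IsIndContained G := by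
  have n1 := hab.ne
  have n2 := hbc.ne
  have n3 := hcd.ne
  have n4 := hde.ne
  have n5 : a ≠ c := fun h => had (h ▸ hcd)
  have n6 : a ≠ d := fun h => hae (h ▸ hde)
  have n7 : a ≠ e := fun h => had (h ▸ hde.symm)
  have n8 : b ≠ d := fun h => hbe (h ▸ hde)
  have n9 : b ≠ e := fun h => hbd (h ▸ hde.symm)
  have n10 : c ≠ e := fun h => hbe (h ▸ hbc)
  refine ⟨⟨⟨![a, b, c, d, e], ?_⟩, ?_⟩⟩
  · intro i j h
    fin_cases i <;> fin_cases j <;> simp_all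
  · intro i j
    change G.Adj (![a, b, c, d, e] i) (![a, b, c, d, e] j) ↔ _
    rw [pathGraph_adj]
    fin_cases i <;> fin_cases j <;>
      simp [ hab, hbc, hcd, hde, hac, had, hae, hbd, hbe, hce, hab.symm, hbc.symm,
        hcd.symm, hde.symm, G.adj_comm c a, G.adj_comm d a, G.adj_comm e a, G.adj_comm d b,
        G.adj_comm e b, G.adj_comm e c]

/-- The vertices `v 0, …, v 4` induce a five-cycle in this order. -/
def IsInducedC5 (G : SimpleGraph V) (v : Fin 5 → V) : Prop :=
  ∀ i j, G.Adj (v i) (v j) ↔ (j = i + 1 ∨ i = j + 1)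

lemma isInducedC5_of_adj {a b c d e : V} (hab : G.Adj a b) (hbc : G.Adj b c)
    (hcd : G.Adj c d) (hde : G.Adj d e) (hea : G.Adj e a) (hac : ¬ G.Adj a c) (had : ¬ G.Adj a d)
    (hbd : ¬ G.Adj b d) (hbe : ¬ G.Adj b e) (hce : ¬ G.Adj c e) :
    G.IsInducedC5 ![a, b, c, d, e] := by
  intro i j
  fin_cases i <;> fin_cases j <;>
    simp [hab, hbc, hcd, hde, hac, had, hea, hbd, hbe, hce, hab.symm, hbc.symm,
      hcd.symm, hde.symm, hea.symm, G.adj_comm c a, G.adj_comm d a, G.adj_comm d b,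
      G.adj_comm e b, G.adj_comm e c]

open Classical in
/-- The members of the cycle `v` that are equal or adjacent to `x`. -/
noncomputable def pattern (G : SimpleGraph V) (v : Fin 5 → V) (x : V) : Fin 5 → Bool :=
  fun i => decide (G.Adj x (v i) ∨ x = v i)

lemma pattern_eq_true_iff {v : Fin 5 → V} {x : V} {i : Fin 5} :
    G.pattern v x i = true ↔ G.Adj x (v i) ∨ x = v i := by
  simp [pattern]

/-- The pattern of a vertex that behaves like the `i`-th vertex of the five-cycle. -/
def clonePattern (i : Fin 5) : Fin 5 → Bool :=
  fun j => decide (j = i ∨ j = i + 1 ∨ i = j + 1)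

/-- The patterns that occur in a graph without induced four-cycles and five-vertex paths. -/
def IsC5Pattern (p : Fin 5 → Bool) : Prop :=
  (∀ i, p i = false) ∨ (∀ i, p i = true) ∨ ∃ i, p = clonePattern i

/-- The first condition will come from the absence of `C_4`, the second from that of `P_5`. Only the
empty set, the full set and three consecutive vertices satisfy both. -/
lemma isC5Pattern_of_forall : ∀ p : Fin 5 → Bool,
    (∀ i, p i = true → p (i + 2) = true → p (i + 1) = true) →
    (∀ i, p i = true → p (i + 1) = false → p (i + 2) = false → p (i + 3) = true) →
    IsC5Pattern p := by
  unfold IsC5Pattern clonePattern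
  decide

/-- Two admissible patterns never differ in exactly one place. -/
lemma IsC5Pattern.eq_of_forall_ne : ∀ p q : Fin 5 → Bool, IsC5Pattern p → IsC5Pattern q →
    ∀ i, (∀ j, j ≠ i → p j = q j) → p i = q i := by
  unfold IsC5Pattern clonePattern
  decide

lemma IsInducedC5.injective {v : Fin 5 → V} (hv : G.IsInducedC5 v) : Function.Injective v := by
  have key : ∀ j k : Fin 5, (∀ l, (l = j + 1 ∨ j = l + 1) ↔ (l = k + 1 ∨ k = l + 1)) → j = k := by
    decide
  intro j k h
  refine key j k fun l => ?_
  rw [← hv, ← hv, h]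

lemma IsInducedC5.pattern_self {v : Fin 5 → V} (hv : G.IsInducedC5 v) (i : Fin 5) :
    G.pattern v (v i) = clonePattern i := by
  funext j
  rw [← Bool.coe_iff_coe, pattern_eq_true_iff, hv, hv.injective.eq_iff, clonePattern,
    decide_eq_true_eq]
  tauto

lemma clonePattern_injective : Function.Injective clonePattern := by
  unfold Function.Injective clonePattern
  decide

lemma IsInducedC5.isC5Pattern (hC4 : ¬ C4.IsIndContained G) (hP5 : ¬ P5.IsIndContained G)
    {v : Fin 5 → V} (hv : G.IsInducedC5 v) (x : V) : IsC5Pattern (G.pattern v x) := by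
  have hadj : ∀ i, G.Adj (v i) (v (i + 1)) := fun i => (hv _ _).2 (Or.inl rfl)
  have hnadj : ∀ i, ¬ G.Adj (v i) (v (i + 2)) := fun i h => by
    have h' := (hv _ _).1 h
    clear h
    revert h' i
    decide
  have hnadj' : ∀ i, ¬ G.Adj (v i) (v (i + 3)) := fun i h => by
    have h' := (hv _ _).1 h
    clear h
    revert h' i
    decide
  have e1 : ∀ i : Fin 5, i + 1 + 1 = i + 2 := by decide
  have e2 : ∀ i : Fin 5, i + 2 + 1 = i + 3 := by decide
  have e3 : ∀ i : Fin 5, i + 1 + 2 = i + 3 := by decide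
  have e4 : ∀ i : Fin 5, i ≠ i + 2 := by decide
  apply isC5Pattern_of_forall
  · intro i h1 h2
    rw [pattern_eq_true_iff] at h1 h2 ⊢
    have ha := hadj (i + 1)
    rw [e1] at ha
    rcases h1 with h1 | rfl
    · rcases h2 with h2 | rfl
      · by_contra! h3
        exact hC4 (C4_isIndContained_of_adj h1 (hadj i) ha h2.symm h3.1 (hnadj i) h3.2
          fun h => e4 i (hv.injective h))
      · exact Or.inl ha.symm
    · exact Or.inl (hadj i)
  · intro i h1 h2 h3
    rw [← Bool.not_eq_true, pattern_eq_true_iff, not_or] at h2 h3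
    rw [pattern_eq_true_iff] at h1 ⊢
    rcases h1 with h1 | rfl
    · by_contra! h4
      have ha := hadj (i + 1)
      have hb := hadj (i + 2)
      have hc := hnadj (i + 1)
      rw [e1] at ha
      rw [e2] at hb
      rw [e3] at hc
      exact hP5 (P5_isIndContained_of_adj h1 (hadj i) ha hb h2.1 h3.1 h4.1 (hnadj i) (hnadj' i) hc)
    · exact absurd (hadj i) h2.1

/-- Replacing a vertex of the five-cycle by a clone. -/
lemma IsInducedC5.update {v : Fin 5 → V} (hv : G.IsInducedC5 v) {x : V} {i : Fin 5}
    (hx : G.pattern v x = clonePattern i) : G.IsInducedC5 (Function.update v i x) := by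
  have hx' : ∀ j, j ≠ i → (G.Adj x (v j) ↔ (j = i + 1 ∨ i = j + 1)) := by
    intro j hj
    have h := congrFun hx j
    rw [← Bool.coe_iff_coe, pattern_eq_true_iff] at h
    simp only [clonePattern, hj, false_or, decide_eq_true_eq] at h
    rw [← h]
    refine ⟨Or.inl, fun h' => h'.resolve_right ?_⟩
    rintro rfl
    exact hj (clonePattern_injective ((hv.pattern_self j).symm.trans hx))
  intro j k
  by_cases hj : j = i <;> by_cases hk : k = i
  · subst hj; subst hk
    simp
  · subst hj
    simp [hk, hx' k hk]
  · subst hk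
    simp [hj, G.adj_comm _ x, hx' j hj, or_comm]
  · simp [hj, hk, hv j k]

/-- Adjacency to a clone of a cycle vertex is determined by the pattern. -/
lemma IsInducedC5.adj_or_eq_clone_iff (hC4 : ¬ C4.IsIndContained G) (hP5 : ¬ P5.IsIndContained G)
    {v : Fin 5 → V} (hv : G.IsInducedC5 v) {x : V} {i : Fin 5}
    (hx : G.pattern v x = clonePattern i) (y : V) :
    (G.Adj y x ∨ y = x) ↔ G.pattern v y i = true := by
  -- The patterns of `y` on the old cycle and on the one with `x` in place of `v i` are both
  -- admissible and agree off `i`, hence also at `i`.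
  have h := IsC5Pattern.eq_of_forall_ne _ _ ((hv.update hx).isC5Pattern hC4 hP5 y)
    (hv.isC5Pattern hC4 hP5 y) i fun j hj => by
      rw [← Bool.coe_iff_coe, pattern_eq_true_iff, pattern_eq_true_iff,
        Function.update_of_ne hj]
  rw [← h, pattern_eq_true_iff, Function.update_self]

lemma IsInducedC5.adj_or_eq_of_universal (hC4 : ¬ C4.IsIndContained G)
    {v : Fin 5 → V} (hv : G.IsInducedC5 v) {x y : V} (hx : ∀ i, G.pattern v x i = true)
    (hy : ∀ i, G.pattern v y i = true) : G.Adj x y ∨ x = y := by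
  have hne : ∀ z, (∀ i, G.pattern v z i = true) → ∀ i, G.Adj z (v i) := by
    intro z hz i
    refine (pattern_eq_true_iff.1 (hz i)).resolve_right ?_
    rintro rfl
    rw [hv.pattern_self] at hz
    clear * - hz
    revert hz i
    unfold clonePattern
    decide
  by_contra! h
  have h02 : ¬ G.Adj (v 0) (v 2) := fun h => by
    have := (hv _ _).1 h
    revert this
    decide
  exact hC4 (C4_isIndContained_of_adj (hne x hx 0) (hne y hy 0).symm (hne y hy 2)
    (hne x hx 2).symm h.1 h02 h.2 fun h => by simpa using hv.injective h)

/-- Every vertex of a `(C_4, P_5)`-free atom has a neighbour on an induced five-cycle. -/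
lemma IsInducedC5.exists_pattern_eq_true (hC4 : ¬ C4.IsIndContained G)
    (hP5 : ¬ P5.IsIndContained G) (hG : G.IsCliqueAtom) {v : Fin 5 → V} (hv : G.IsInducedC5 v)
    (z : V) : ∃ i, G.pattern v z i = true := by
  by_contra! hz
  set U : Set V := {x | ∀ i, G.pattern v x i = true} with hU
  have hconn : (G.induce Uᶜ).Preconnected := by
    by_contra hc
    refine hG U ⟨fun x hx y hy hxy => ?_, hc⟩
    exact (hv.adj_or_eq_of_universal hC4 hx hy).resolve_right hxy
  have hzU : z ∈ Uᶜ := fun h => hz 0 (h 0)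
  have h0U : v 0 ∈ Uᶜ := fun h => by
    have := h 2
    rw [hv.pattern_self] at this
    revert this
    unfold clonePattern
    decide
  -- Seeing nothing on the cycle spreads along walks outside `U`: a neighbour imitating `v j` would
  -- force the previous vertex to see `v j`. Such a walk never reaches the cycle.
  have hclosed : ∀ x : ↥(Uᶜ), (G.induce Uᶜ).Reachable ⟨z, hzU⟩ x →
      ∀ i, ¬ G.pattern v x i = true := by
    intro x hx
    rw [reachable_iff_reflTransGen] at hx
    induction hx with
    | refl => exact hz
    | @tail x y _ hxy ih =>
      intro i hi
      rcases hv.isC5Pattern hC4 hP5 (y : V) with h | h | ⟨j, hj⟩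
      · rw [h i] at hi
        cases hi
      · exact y.2 h
      · exact ih j ((hv.adj_or_eq_clone_iff hC4 hP5 hj _).1 (Or.inl hxy))
  refine hclosed _ (hconn _ ⟨v 0, h0U⟩) 0 ?_
  rw [pattern_eq_true_iff]
  exact Or.inr rfl

/-- The relation between the patterns of equal or adjacent vertices. -/
def PatternRel (p q : Fin 5 → Bool) : Prop :=
  (∃ i, p = clonePattern i ∧ q i = true) ∨ (∃ i, q = clonePattern i ∧ p i = true) ∨
    ((∀ i, p i = true) ∧ ∀ i, q i = true)

lemma IsInducedC5.adj_or_eq_iff (hC4 : ¬ C4.IsIndContained G)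
    (hP5 : ¬ P5.IsIndContained G) (hG : G.IsCliqueAtom) {v : Fin 5 → V} (hv : G.IsInducedC5 v)
    (x y : V) : (G.Adj x y ∨ x = y) ↔ PatternRel (G.pattern v x) (G.pattern v y) := by
  have hcl : ∀ x y i, G.pattern v x = clonePattern i →
      ((G.Adj x y ∨ x = y) ↔ G.pattern v y i = true) := by
    intro x y i hx
    rw [← hv.adj_or_eq_clone_iff hC4 hP5 hx y, G.adj_comm, eq_comm]
  have hsymm : ∀ x y, (G.Adj x y ∨ x = y) ↔ (G.Adj y x ∨ y = x) := by
    intro x y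
    rw [G.adj_comm, eq_comm]
  constructor
  · intro h
    obtain ⟨a, ha⟩ := hv.exists_pattern_eq_true hC4 hP5 hG x
    obtain ⟨b, hb⟩ := hv.exists_pattern_eq_true hC4 hP5 hG y
    rcases hv.isC5Pattern hC4 hP5 x with hx | hx | ⟨i, hx⟩
    · rw [hx a] at ha
      cases ha
    · rcases hv.isC5Pattern hC4 hP5 y with hy | hy | ⟨j, hy⟩
      · rw [hy b] at hb
        cases hb
      · exact Or.inr (Or.inr ⟨hx, hy⟩)
      · exact Or.inr (Or.inl ⟨j, hy, hx j⟩)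
    · exact Or.inl ⟨i, hx, (hcl x y i hx).1 h⟩
  · rintro (⟨i, hx, h⟩ | ⟨i, hy, h⟩ | ⟨hx, hy⟩)
    · exact (hcl x y i hx).2 h
    · exact (hsymm x y).2 ((hcl y x i hy).2 h)
    · exact hv.adj_or_eq_of_universal hC4 hx hy

theorem IsInducedC5.cliqueWidth_le [Finite V] [Nonempty V] (hC4 : ¬ C4.IsIndContained G)
    (hP5 : ¬ P5.IsIndContained G) (hG : G.IsCliqueAtom) {v : Fin 5 → V} (hv : G.IsInducedC5 v) :
    G.cliqueWidth ≤ (33 : ℕ) := by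
  -- All 32 subsets of the cycle serve as types; one spare label gives 33.
  let e : (Fin 5 → Bool) ≃ Fin 32 := Fintype.equivFinOfCardEq (by simp)
  refine cliqueWidth_le_of_types (fun x => e (G.pattern v x))
    (fun i j => PatternRel (e.symm i) (e.symm j)) fun x y hxy => ?_
  rw [e.symm_apply_apply, e.symm_apply_apply, ← hv.adj_or_eq_iff hC4 hP5 hG, or_iff_left hxy]

theorem cliqueWidth_le_of_isClique [Finite V] [Nonempty V] (h : ∀ x y, x ≠ y → G.Adj x y) :
    G.cliqueWidth ≤ (33 : ℕ) :=
  (cliqueWidth_le_of_types (k := 1) (fun _ => 0) (fun _ _ => True)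
    fun x y hxy => iff_of_true (h x y hxy) trivial).trans (by norm_num)

end SimpleGraph

/-! ### Minimal separators and the existence of a five-cycle -/

namespace SimpleGraph

variable {V : Type} {G : SimpleGraph V}

/-- In a graph without induced `P_5`, two non-adjacent connected vertices have distance two
or three. -/
lemma exists_induced_path_of_reachable (hP5 : ¬ P5.IsIndContained G) {s t : V}
    (hr : G.Reachable s t) (hne : s ≠ t) (hst : ¬ G.Adj s t) :
    (∃ x, G.Adj s x ∧ G.Adj x t) ∨
      ∃ x y, G.Adj s x ∧ G.Adj x y ∧ G.Adj y t ∧ ¬ G.Adj s y ∧ ¬ G.Adj x t := by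
  -- A shortest walk is an induced path, and with length at least four it would contain an induced
  -- `P_5`.
  obtain ⟨p, hp⟩ := hr.exists_walk_length_eq_dist
  have hd : ∀ i ≤ p.length, G.dist s (p.getVert i) = i := by
    intro i hi
    have h1 := dist_le (p.take i)
    have h2 := dist_le (p.drop i)
    have h3 := ((p.take i).reachable).dist_triangle_left t
    rw [Walk.take_length] at h1
    rw [Walk.drop_length] at h2
    omega
  have hnadj : ∀ i j, i + 2 ≤ j → j ≤ p.length → ¬ G.Adj (p.getVert i) (p.getVert j) := by
    intro i j hij hj h
    have h1 := ((p.take i).reachable).dist_triangle_left (p.getVert j)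
    rw [dist_eq_one_iff_adj.2 h, hd i (by omega), hd j hj] at h1
    omega
  have hadj : ∀ i, i < p.length → G.Adj (p.getVert i) (p.getVert (i + 1)) := fun i hi =>
    p.adj_getVert_succ hi
  have h0 : p.length ≠ 0 := fun h => hne (Walk.eq_of_length_eq_zero h)
  have h1 : p.length ≠ 1 := fun h => hst (dist_eq_one_iff_adj.1 (hp ▸ h))
  have hs := p.getVert_zero
  have ht := p.getVert_length
  rcases Nat.lt_or_ge p.length 4 with hl | hl
  · obtain hl | hl : p.length = 2 ∨ p.length = 3 := by omega
    · left
      rw [hl] at ht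
      have a0 := hadj 0 (by omega)
      have a1 := hadj 1 (by omega)
      rw [hs] at a0
      rw [ht] at a1
      exact ⟨_, a0, a1⟩
    · right
      rw [hl] at ht
      have a0 := hadj 0 (by omega)
      have a1 := hadj 1 (by omega)
      have a2 := hadj 2 (by omega)
      have b0 := hnadj 0 2 (by omega) (by omega)
      have b1 := hnadj 1 3 (by omega) (by omega)
      rw [hs] at a0 b0
      rw [ht] at a2 b1
      exact ⟨_, _, a0, a1, a2, b0, b1⟩
  · exact (hP5 (P5_isIndContained_of_adj (hadj 0 (by omega)) (hadj 1 (by omega))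
      (hadj 2 (by omega)) (hadj 3 (by omega)) (hnadj 0 2 (by omega) (by omega))
      (hnadj 0 3 (by omega) (by omega)) (hnadj 0 4 (by omega) (by omega))
      (hnadj 1 3 (by omega) (by omega)) (hnadj 1 4 (by omega) (by omega))
      (hnadj 2 4 (by omega) (by omega)))).elim

/-- `v` can be reached from `a` by a walk whose later vertices avoid `S`. -/
def ReachAvoiding (G : SimpleGraph V) (S : Set V) (a v : V) : Prop :=
  Relation.ReflTransGen (fun u w => G.Adj u w ∧ w ∉ S) a v

lemma ReachAvoiding.notMem {S : Set V} {a v : V} (h : G.ReachAvoiding S a v) (ha : a ∉ S) :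
    v ∉ S := by
  rcases Relation.ReflTransGen.cases_tail h with rfl | ⟨w, -, hw⟩
  · exact ha
  · exact hw.2

lemma ReachAvoiding.symm {S : Set V} {a v : V} (h : G.ReachAvoiding S a v) (ha : a ∉ S) :
    G.ReachAvoiding S v a := by
  induction h with
  | refl => exact Relation.ReflTransGen.refl
  | @tail u w hau huw ih =>
    exact Relation.ReflTransGen.head ⟨huw.1.symm, ReachAvoiding.notMem hau ha⟩ ih

lemma reachAvoiding_of_reachable_induce {S : Set V} {a b : ↥(Sᶜ)}
    (h : (G.induce Sᶜ).Reachable a b) : G.ReachAvoiding S a b := by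
  rw [reachable_iff_reflTransGen] at h
  exact h.lift Subtype.val fun u w huw => ⟨huw, w.2⟩

lemma ReachAvoiding.reachable_induce {S D : Set V} {a v : V} (h : G.ReachAvoiding S a v)
    (hD : ∀ w, G.ReachAvoiding S a w → w ∈ D) :
    (G.induce D).Reachable ⟨a, hD a Relation.ReflTransGen.refl⟩ ⟨v, hD v h⟩ := by
  induction h with
  | refl => exact Reachable.refl _
  | @tail u w hau huw ih =>
    exact ih.trans (Adj.reachable (G := G.induce D) (u := ⟨u, hD u hau⟩)
      (v := ⟨w, hD w (hau.tail huw)⟩) huw.1)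

/-- Two non-adjacent vertices with neighbours in a component of `G - S` are joined by a short path
through that component. -/
lemma exists_induced_path_through_component (hP5 : ¬ P5.IsIndContained G) {S : Set V} {a s t : V}
    (hne : s ≠ t) (hst : ¬ G.Adj s t) (hs : ∃ x, G.ReachAvoiding S a x ∧ G.Adj s x)
    (ht : ∃ x, G.ReachAvoiding S a x ∧ G.Adj t x) :
    (∃ x, G.ReachAvoiding S a x ∧ G.Adj s x ∧ G.Adj x t) ∨
      ∃ x y, G.ReachAvoiding S a x ∧ G.ReachAvoiding S a y ∧
        G.Adj s x ∧ G.Adj x y ∧ G.Adj y t ∧ ¬ G.Adj s y ∧ ¬ G.Adj x t := by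
  let D : Set V := {w | G.ReachAvoiding S a w ∨ w = s ∨ w = t}
  have hD : ∀ w, G.ReachAvoiding S a w → w ∈ D := fun w hw => Or.inl hw
  have hsD : s ∈ D := Or.inr (Or.inl rfl)
  have htD : t ∈ D := Or.inr (Or.inr rfl)
  have hP5' : ¬ P5.IsIndContained (G.induce D) := fun h =>
    hP5 (h.trans ⟨Embedding.induce D⟩)
  have hr : (G.induce D).Reachable ⟨s, hsD⟩ ⟨t, htD⟩ := by
    obtain ⟨x, hx, hsx⟩ := hs
    obtain ⟨y, hy, hty⟩ := ht
    have h1 : (G.induce D).Adj ⟨s, hsD⟩ ⟨x, hD x hx⟩ := hsx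
    have h2 : (G.induce D).Adj ⟨t, htD⟩ ⟨y, hD y hy⟩ := hty
    exact h1.reachable.trans ((hx.reachable_induce hD).symm.trans
      ((hy.reachable_induce hD).trans h2.symm.reachable))
  rcases exists_induced_path_of_reachable hP5' hr (fun h => hne (congrArg Subtype.val h)) hst with
    ⟨⟨x, hx⟩, h1, h2⟩ | ⟨⟨x, hx⟩, ⟨y, hy⟩, h1, h2, h3, h4, h5⟩
  · left
    change G.Adj s x at h1
    change G.Adj x t at h2
    refine ⟨x, hx.resolve_right ?_, h1, h2⟩
    rintro (rfl | rfl)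
    · exact hst h2
    · exact hst h1
  · right
    change G.Adj s x at h1
    change G.Adj x y at h2
    change G.Adj y t at h3
    refine ⟨x, y, hx.resolve_right ?_, hy.resolve_right ?_, h1, h2, h3, h4, h5⟩
    · rintro (rfl | rfl)
      · exact G.loopless.irrefl _ h1
      · exact hst h1
    · rintro (rfl | rfl)
      · exact hst h3
      · exact G.loopless.irrefl _ h3

/-- A minimal separator: each of its vertices has neighbours on both sides. -/
lemma exists_minimal_separator [Finite V] {a b : V} (hab : a ≠ b) (hadj : ¬ G.Adj a b) :
    ∃ S : Set V, a ∉ S ∧ b ∉ S ∧ ¬ G.ReachAvoiding S a b ∧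
      (∀ s ∈ S, ∃ x, G.ReachAvoiding S a x ∧ G.Adj s x) ∧
      ∀ s ∈ S, ∃ x, G.ReachAvoiding S b x ∧ G.Adj s x := by
  obtain ⟨S, ⟨ha, hb, hS⟩, hmin⟩ := exists_minimal_of_wellFoundedLT
    (fun S : Set V => a ∉ S ∧ b ∉ S ∧ ¬ G.ReachAvoiding S a b) ⟨{a, b}ᶜ, by simp, by simp, by
      intro h
      have key : ∀ v, G.ReachAvoiding {a, b}ᶜ a v → v = a := by
        intro v hv
        induction hv with
        | refl => rfl
        | @tail u w _ huw ih =>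
          subst ih
          have h2 := huw.2
          rw [Set.notMem_compl_iff] at h2
          rcases h2 with h2 | h2
          · exact h2
          · rw [Set.mem_singleton_iff] at h2
            exact absurd (h2 ▸ huw.1) hadj
      exact hab (key b h).symm⟩
  have hreach : ∀ s ∈ S, G.ReachAvoiding (S \ {s}) a b := by
    intro s hs
    by_contra hc
    have hle : S ≤ S \ {s} := hmin ⟨fun h => ha h.1, fun h => hb h.1, hc⟩ Set.sdiff_subset
    exact (hle hs).2 rfl
  -- If no vertex reached from `c` were adjacent to `s`, the walk avoiding `S \ {s}` could never
  -- enter `s` and would avoid `S` altogether.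
  have hnbr : ∀ s ∈ S, ∀ c d, G.ReachAvoiding (S \ {s}) c d → ¬ G.ReachAvoiding S c d →
      ∃ x, G.ReachAvoiding S c x ∧ G.Adj s x := by
    intro s hs c d h hS'
    by_contra! hc
    apply hS'
    clear hS'
    induction h with
    | refl => exact Relation.ReflTransGen.refl
    | @tail u w _ huw ih =>
      refine Relation.ReflTransGen.tail ih ⟨huw.1, fun hw => huw.2 ⟨hw, ?_⟩⟩
      rintro rfl
      exact hc u ih huw.1.symm
  refine ⟨S, ha, hb, hS, fun s hs => hnbr s hs a b (hreach s hs) hS, fun s hs => ?_⟩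
  exact hnbr s hs b a ((hreach s hs).symm fun h => ha h.1) fun h => hS (h.symm hb)

theorem IsCliqueAtom.exists_isInducedC5 [Finite V] (hC4 : ¬ C4.IsIndContained G)
    (hP5 : ¬ P5.IsIndContained G) (hG : G.IsCliqueAtom) {a b : V} (hab : a ≠ b)
    (hadj : ¬ G.Adj a b) : ∃ v, G.IsInducedC5 v := by
  obtain ⟨S, ha, hb, hS, hSa, hSb⟩ := exists_minimal_separator hab hadj
  obtain ⟨s, hs, t, ht, hne, hst⟩ : ∃ s ∈ S, ∃ t ∈ S, s ≠ t ∧ ¬ G.Adj s t := by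
    by_contra! hc
    refine hG S ⟨fun s hs t ht hne => hc s hs t ht hne, fun h => hS ?_⟩
    exact reachAvoiding_of_reachable_induce (h ⟨a, ha⟩ ⟨b, hb⟩)
  have hsep : ∀ x y, G.ReachAvoiding S a x → G.ReachAvoiding S b y → x ≠ y ∧ ¬ G.Adj x y := by
    intro x y hx hy
    have hyb := hy.symm hb
    refine ⟨?_, fun h => ?_⟩
    · rintro rfl
      exact hS (hx.trans hyb)
    · exact hS ((hx.tail ⟨h, hy.notMem hb⟩).trans hyb)
  -- The two paths from `s` to `t` have length two or three and close up to an induced cycle.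
  -- Lengths `2 + 2` give `C_4`, `2 + 3` the desired five-cycle, and `3 + 3` a six-cycle, from which
  -- deleting `s` leaves `P_5`.
  rcases exists_induced_path_through_component hP5 hne hst (hSa s hs) (hSa t ht) with
    ⟨x, hx, hsx, hxt⟩ | ⟨x, x', hx, hx', hsx, hxx', hx't, hsx', hxt⟩ <;>
  rcases exists_induced_path_through_component hP5 hne hst (hSb s hs) (hSb t ht) with
    ⟨y, hy, hsy, hyt⟩ | ⟨y, y', hy, hy', hsy, hyy', hy't, hsy', hyt⟩
  · exact (hC4 (C4_isIndContained_of_adj hsx hxt hyt.symm hsy.symm hst (hsep x y hx hy).2 hne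
      (hsep x y hx hy).1)).elim
  · exact ⟨_, isInducedC5_of_adj hsx hxt hy't.symm hyy'.symm hsy.symm hst hsy'
      (hsep x y' hx hy').2 (hsep x y hx hy).2 fun h => hyt h.symm⟩
  · exact ⟨_, isInducedC5_of_adj hsy hyt hx't.symm hxx'.symm hsx.symm hst hsx'
      (fun h => (hsep x' y hx' hy).2 h.symm) (fun h => (hsep x y hx hy).2 h.symm)
      fun h => hxt h.symm⟩
  · exact (hP5 (P5_isIndContained_of_adj hxx' hx't hy't.symm hyy'.symm hxt
      (hsep x y' hx hy').2 (hsep x y hx hy).2 (hsep x' y' hx' hy').2 (hsep x' y hx' hy).2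
      fun h => hyt h.symm)).elim

end SimpleGraph

/-! ### The bounded class and the main theorem -/

theorem boundedCliqueWidth_freeAtoms_C4_P5 : BoundedCliqueWidth (freeAtoms {.of C4, .of P5}) := by
  refine ⟨33, fun G hG => ?_⟩
  obtain ⟨hatom, hfree⟩ := hG
  have hC4 : ¬ C4.IsIndContained G.graph := hfree (.of C4) (by simp)
  have hP5 : ¬ P5.IsIndContained G.graph := hfree (.of P5) (by simp)
  -- Complete graphs are atoms without an induced five-cycle and need a separate bound.
  by_cases h : ∀ x y, x ≠ y → G.graph.Adj x y
  · exact SimpleGraph.cliqueWidth_le_of_isClique h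
  · push Not at h
    obtain ⟨a, b, hab, hadj⟩ := h
    obtain ⟨v, hv⟩ := hatom.exists_isInducedC5 hC4 hP5 hab hadj
    exact hv.cliqueWidth_le hC4 hP5 hatom

theorem mainTheorem7 :
    -- (2P_2, co-P_5, co-3P_2)-free atoms have unbounded clique-width
    UnboundedCliqueWidth (freeAtoms {.of twoP2, .of P5ᶜ, .of threeP2ᶜ}) ∧
    -- walls are bipartite
    (∀ k : ℕ, 2 ≤ k → ∃ A : Set (WallVertex k), (wall k).IsBipartiteWith A Aᶜ) ∧
    -- the graphs obtained from walls belong to the class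
    (∀ k : ℕ, 2 ≤ k → ∀ A : Set (WallVertex k), (wall k).IsBipartiteWith A Aᶜ →
      FinGraph.of ((wall k).cliqueAddTwins A) ∈
        freeAtoms {.of twoP2, .of P5ᶜ, .of threeP2ᶜ}) ∧
    -- and already have unbounded clique-width, whichever sides of the walls are made cliques
    (∀ A : (k : ℕ) → Set (WallVertex k),
      (∀ k : ℕ, 2 ≤ k → (wall k).IsBipartiteWith (A k) (A k)ᶜ) →
      UnboundedCliqueWidth
        {G | ∃ k : ℕ, 2 ≤ k ∧ G = FinGraph.of ((wall k).cliqueAddTwins (A k))}) ∧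
    -- (co-C_4, co-P_5)-free atoms have unbounded clique-width
    UnboundedCliqueWidth (freeAtoms {.of C4ᶜ, .of P5ᶜ}) ∧
    -- (C_4, P_5)-free atoms have bounded clique-width
    BoundedCliqueWidth (freeAtoms {.of C4, .of P5}) :=
  ⟨unboundedCliqueWidth_freeAtoms, fun k _ => wall_isBipartiteWith k,
    fun _ hk _ hA => cliqueAddTwins_wall_mem_freeAtoms hk hA,
    unboundedCliqueWidth_cliqueAddTwins_wall, unboundedCliqueWidth_freeAtoms_coC4,
    boundedCliqueWidth_freeAtoms_C4_P5⟩
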